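/- **Theorem ($\ell$-duality).** Let $\Lambda$ be the Leech lattice, let $O(\Lambda)=Co_0$ be its isometry group, and let $\hat\Lambda$ be the central extension $1\to\{\pm1\}\to\hat\Lambda\to\Lambda\to1$ with commutator map $(\alpha,\beta)\mapsto(-1)^{\langle\alpha,\beta\rangle}$; choose elements $e^\alpha\in\hat\Lambda$ above $\alpha\in\Lambda$. For $\tau\in O(\Lambda)$ let $\Lambda^\tau=\{v\in\Lambda:\tau v=v\}$ be the fixed-point lattice and let $(\Lambda^\tau)^*=\{v\in\mathbb R\Lambda^\tau:\langle v,w\rangle\in\mathbb Z\text{ for all }w\in\Lambda^\tau\}$ be its dual. A *standard lift* of $\tau$ is an automorphism $\hat\tau$ of the group $\hat\Lambda$ that induces $\tau$ on $\Lambda$ and satisfies $\hat\tau(e^\alpha)=e^\alpha$ for all $\alpha\in\Lambda^\tau$. Let $\mathcal P_0\subset O(\Lambda)$ be the union of the eleven conjugacy classes $1A$, $2A$, $2C$, $3B$, $4C$, $5B$, $6E$, $6G$, $7B$, $8E$, $10F$, whose frame shapes are, in this order, $$1^{24},\ 1^82^8,\ 2^{12},\ 1^63^6,\ 1^42^24^4,\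 1^45^4,\ 1^22^23^26^2,\ 2^36^3,\ 1^37^3,\ 1^22^14^18^2,\ 2^210^2$$ (an isometry has frame shape $\prod_k k^{a_k}$ if its characteristic polynomial is $\prod_k(X^k-1)^{a_k}$). Let $\tau\in\mathcal P_0$. Then $\tau$ has a standard lift, and for every standard lift $\hat\tau$ of $\tau$, with $\ell=|\hat\tau|$ its order, there is an isometry $$\varphi_\tau:\ \sqrt{\ell}\,(\Lambda^\tau)^*\ \longrightarrow\ \Lambda^\tau$$ of lattices, that is, an isomorphism of abelian groups from $\sqrt{\ell}\,(\Lambda^\tau)^*$ onto $\Lambda^\tau$ that preserves inner products. -/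

import Mathlib

open scoped Pointwise

noncomputable section

namespace LeechDuality

/-! ### The extended binary Golay code -/

/-- The bordered circulant `B`: the index `0` is the border, the indices `1, …, 11` are residues
modulo `11`, and for those `B i j = 1` iff `i - j` is a square modulo `11`. -/
def golayB (i j : Fin 12) : ZMod 2 :=
  if i = 0 ∨ j = 0 then (if i = j then 0 else 1)
  else if ((i : ℕ) + 11 - j) % 11 ∈ [0, 1, 3, 4, 5, 9] then 1 else 0

/-- The extended binary Golay code: the row space of the generator matrix `[I | B]`, that is, the
words `(u, u B)` with `u` in `F_2 ^ 12`. -/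
def golayCode : Submodule (ZMod 2) (Fin 24 → ZMod 2) where
  carrier := {c | ∀ j : Fin 12,
    c (Fin.natAdd 12 j) = ∑ i : Fin 12, c (Fin.castAdd 12 i) * golayB i j}
  zero_mem' := by intro j; simp
  add_mem' := by
    intro a b ha hb j
    simp only [Pi.add_apply, add_mul, Finset.sum_add_distrib]
    rw [ha j, hb j]
  smul_mem' := by
    intro r a ha j
    simp only [Pi.smul_apply, smul_eq_mul, mul_assoc, ← Finset.mul_sum]
    rw [ha j]

/-! ### Basic properties of the Golay code -/

/-- The rows of the generator matrix `[I | B]`. -/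
def golayRow (k : Fin 12) : Fin 24 → ZMod 2 :=
  Fin.addCases (m := 12) (n := 12) (fun i => if i = k then 1 else 0) (fun j => golayB k j)

theorem golayRow_left (k i : Fin 12) :
    golayRow k (Fin.castAdd 12 i) = if i = k then 1 else 0 :=
  Fin.addCases_left (m := 12) (n := 12) i

theorem golayRow_right (k j : Fin 12) : golayRow k (Fin.natAdd 12 j) = golayB k j :=
  Fin.addCases_right (m := 12) (n := 12) j

instance (c : Fin 24 → ZMod 2) : Decidable (c ∈ golayCode) :=
  inferInstanceAs (Decidable (∀ j : Fin 12,
    c (Fin.natAdd 12 j) = ∑ i : Fin 12, c (Fin.castAdd 12 i) * golayB i j))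

theorem sum_split {M : Type*} [AddCommMonoid M] (f : Fin 24 → M) :
    ∑ i, f i = ∑ i : Fin 12, f (Fin.castAdd 12 i) + ∑ j : Fin 12, f (Fin.natAdd 12 j) :=
  Fin.sum_univ_add (a := 12) (b := 12) f

theorem eq_sum_golayRow {c : Fin 24 → ZMod 2} (hc : c ∈ golayCode) :
    c = ∑ k : Fin 12, c (Fin.castAdd 12 k) • golayRow k := by
  funext i
  rw [Finset.sum_apply]
  refine Fin.addCases (m := 12) (n := 12) (fun a => ?_) (fun b => ?_) i
  · simp only [Pi.smul_apply, golayRow_left, smul_eq_mul]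
    simp
  · simp only [Pi.smul_apply, golayRow_right, smul_eq_mul]
    exact hc b

theorem golayB_orth : ∀ i k : Fin 12, ∑ j, golayB i j * golayB k j = if i = k then 1 else 0 := by
  decide +kernel

theorem golayCode_orth {c d : Fin 24 → ZMod 2} (hc : c ∈ golayCode) (hd : d ∈ golayCode) :
    ∑ i, c i * d i = 0 := by
  have h : ∑ j : Fin 12, c (Fin.natAdd 12 j) * d (Fin.natAdd 12 j) =
      ∑ i : Fin 12, c (Fin.castAdd 12 i) * d (Fin.castAdd 12 i) := by
    calc ∑ j : Fin 12, c (Fin.natAdd 12 j) * d (Fin.natAdd 12 j)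
        = ∑ j : Fin 12, ∑ i : Fin 12, ∑ k : Fin 12,
            c (Fin.castAdd 12 i) * d (Fin.castAdd 12 k) * (golayB i j * golayB k j) := by
          refine Finset.sum_congr rfl fun j _ => ?_
          rw [hc j, hd j, Finset.sum_mul_sum]
          refine Finset.sum_congr rfl fun i _ => Finset.sum_congr rfl fun k _ => ?_
          ring
      _ = ∑ i : Fin 12, ∑ k : Fin 12, ∑ j : Fin 12,
            c (Fin.castAdd 12 i) * d (Fin.castAdd 12 k) * (golayB i j * golayB k j) := by
          rw [Finset.sum_comm]
          exact Finset.sum_congr rfl fun i _ => Finset.sum_comm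
      _ = _ := by
          refine Finset.sum_congr rfl fun i _ => ?_
          simp [← Finset.mul_sum, golayB_orth]
  rw [sum_split, h]
  exact CharTwo.add_self_eq_zero _

theorem even_sum_mul {c d : Fin 24 → ℤ} (hc : (fun i => (c i : ZMod 2)) ∈ golayCode)
    (hd : (fun i => (d i : ZMod 2)) ∈ golayCode) : (2 : ℤ) ∣ ∑ i, c i * d i := by
  have h := golayCode_orth hc hd
  refine (ZMod.intCast_zmod_eq_zero_iff_dvd _ 2).mp ?_
  push_cast
  exact h

theorem four_dvd_sum_sq_row : ∀ k : Fin 12, 4 ∣ ∑ i, ((golayRow k i).val : ℤ) ^ 2 := by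
  decide +kernel

/-- The Golay code is doubly even. -/
theorem four_dvd_sum_sq {c : Fin 24 → ℤ} (hc : (fun i => (c i : ZMod 2)) ∈ golayCode) :
    (4 : ℤ) ∣ ∑ i, c i ^ 2 := by
  have hrow : ∀ k, golayRow k ∈ golayCode := by
    intro k j
    simp only [golayRow_left, golayRow_right]
    simp
  have hcast : ∀ k i, (((golayRow k i).val : ℤ) : ZMod 2) = golayRow k i := by
    intro k i; simp
  have step : ∀ s : Finset (Fin 12), ∃ e : Fin 24 → ℤ,
      (fun i => (e i : ZMod 2)) = ∑ k ∈ s, (c (Fin.castAdd 12 k) : ZMod 2) • golayRow k ∧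
      (4 : ℤ) ∣ ∑ i, e i ^ 2 := by
    intro s
    induction s using Finset.induction_on with
    | empty => exact ⟨0, by simp [Pi.zero_def], by simp⟩
    | insert a s ha ih =>
      obtain ⟨e, he, h4⟩ := ih
      refine ⟨fun i => e i + c (Fin.castAdd 12 a) * (golayRow a i).val, ?_, ?_⟩
      · rw [Finset.sum_insert ha, ← he]
        funext i
        simp [add_comm]
      · have heg : (fun i => (e i : ZMod 2)) ∈ golayCode := by
          rw [he]
          exact golayCode.sum_mem fun k _ => golayCode.smul_mem _ (hrow k)
        have hag : (fun i => (((golayRow a i).val : ℤ) : ZMod 2)) ∈ golayCode := by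
          simp only [hcast]; exact hrow a
        obtain ⟨u, hu⟩ := even_sum_mul heg hag
        obtain ⟨v, hv⟩ := h4
        obtain ⟨w, hw⟩ := four_dvd_sum_sq_row a
        have : ∑ i, (e i + c (Fin.castAdd 12 a) * (golayRow a i).val) ^ 2 =
            ∑ i, e i ^ 2 + 2 * c (Fin.castAdd 12 a) * ∑ i, e i * ((golayRow a i).val : ℤ) +
            c (Fin.castAdd 12 a) ^ 2 * ∑ i, ((golayRow a i).val : ℤ) ^ 2 := by
          simp only [Finset.mul_sum, ← Finset.sum_add_distrib]
          exact Finset.sum_congr rfl fun i _ => by ring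
        rw [this, hu, hv, hw]
        exact ⟨v + c (Fin.castAdd 12 a) * u + c (Fin.castAdd 12 a) ^ 2 * w, by ring⟩
  obtain ⟨e, he, h4⟩ := step Finset.univ
  rw [← eq_sum_golayRow hc] at he
  have hd : ∀ i, (4 : ℤ) ∣ c i ^ 2 - e i ^ 2 := by
    intro i
    have h := congrFun he i
    rw [eq_comm, ← sub_eq_zero, ← Int.cast_sub, ZMod.intCast_zmod_eq_zero_iff_dvd _ 2] at h
    obtain ⟨t, ht⟩ := h
    exact ⟨t * (t + e i), by
      have : c i = e i + 2 * t := by push_cast at ht; linarith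
      rw [this]; ring⟩
  have := dvd_add (Finset.dvd_sum fun i (_ : i ∈ Finset.univ) => hd i) h4
  simpa [Finset.sum_sub_distrib] using this

/-! ### The Leech lattice -/

/-- The Euclidean space in which the Leech lattice lives. -/
abbrev Space : Type := EuclideanSpace ℝ (Fin 24)

/-- The vectors `√8 v` for `v` in the Leech lattice, in the standard coordinates: integral vectors
`x` for which there is an integer `m` such that all `x i` are congruent to `m` modulo `2`, the word
`((x i - m) / 2) mod 2` is in the Golay code, and the sum of the `x i` is `4 m` modulo `8`. -/
def leechInt : Submodule ℤ (Fin 24 → ℤ) where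
  carrier := {x | ∃ (m : ℤ) (c : Fin 24 → ℤ), (fun i => (c i : ZMod 2)) ∈ golayCode ∧
    (∀ i, x i = m + 2 * c i) ∧ (8 : ℤ) ∣ (∑ i, x i) - 4 * m}
  zero_mem' := ⟨0, 0, by simpa [Pi.zero_def] using golayCode.zero_mem, by simp, by simp⟩
  add_mem' := by
    rintro x y ⟨m, c, hc, hx, hs⟩ ⟨n, d, hd, hy, ht⟩
    refine ⟨m + n, c + d, ?_, ?_, ?_⟩
    · simpa [Pi.add_def] using golayCode.add_mem hc hd
    · intro i
      simp only [Pi.add_apply, hx i, hy i]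
      ring
    · have h := dvd_add hs ht
      simp only [Pi.add_apply, Finset.sum_add_distrib]
      rwa [show ∑ i, x i + ∑ i, y i - 4 * (m + n) =
        ∑ i, x i - 4 * m + (∑ i, y i - 4 * n) by ring]
  smul_mem' := by
    rintro r x ⟨m, c, hc, hx, hs⟩
    refine ⟨r * m, r • c, ?_, ?_, ?_⟩
    · simpa [Pi.smul_def] using golayCode.smul_mem (r : ZMod 2) hc
    · intro i
      simp only [Pi.smul_apply, smul_eq_mul, hx i]
      ring
    · have h := Dvd.dvd.mul_left hs r
      simp only [Pi.smul_apply, smul_eq_mul, ← Finset.mul_sum]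
      rwa [show r * ∑ i, x i - 4 * (r * m) = r * (∑ i, x i - 4 * m) by ring]

/-- The map `x ↦ x / √8` from `ℤ ^ 24` to Euclidean space. -/
def scaledEmb : (Fin 24 → ℤ) →ₗ[ℤ] Space where
  toFun x := WithLp.toLp 2 (fun i => (x i : ℝ) / √8)
  map_add' x y := by ext i; simp [add_div]
  map_smul' r x := by ext i; simp [mul_div_assoc]

/-- The Leech lattice `Λ`. -/
def leech : Submodule ℤ Space := leechInt.map scaledEmb

/-- `Co_0 = O(Λ)`: as `Λ` spans `Space`, an isometry of `Λ` is the same thing as a linear isometry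
of `Space` that preserves `Λ`. -/
def Co0 : Subgroup (Space ≃ₗᵢ[ℝ] Space) where
  carrier := {g | ∀ v, g v ∈ leech ↔ v ∈ leech}
  one_mem' := fun _ => Iff.rfl
  mul_mem' := fun {a b} ha hb v => (ha (b v)).trans (hb v)
  inv_mem' := fun {a} ha v => by
    have h := ha (a⁻¹ v)
    rwa [show a (a⁻¹ v) = v from a.apply_symm_apply v, Iff.comm] at h

/-- The fixed-point lattice `Λ^τ`. -/
def fixedLattice (τ : Co0) : Submodule ℤ Space where
  carrier := {v | v ∈ leech ∧ (τ : Space ≃ₗᵢ[ℝ] Space) v = v}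
  zero_mem' := ⟨leech.zero_mem, map_zero _⟩
  add_mem' := fun ha hb => ⟨leech.add_mem ha.1 hb.1, by rw [map_add, ha.2, hb.2]⟩
  smul_mem' := fun r v hv => ⟨leech.smul_mem r hv.1, by rw [map_zsmul, hv.2]⟩

/-- The dual lattice `L*`: the vectors of the real span of `L` with integral inner products with
all vectors of `L`. -/
def dualLattice (L : Submodule ℤ Space) : Submodule ℤ Space where
  carrier := {v | v ∈ Submodule.span ℝ (L : Set Space) ∧
    ∀ w ∈ L, ∃ n : ℤ, inner ℝ v w = (n : ℝ)}
  zero_mem' := ⟨Submodule.zero_mem _, fun w _ => ⟨0, by simp⟩⟩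
  add_mem' := by
    rintro a b ⟨ha, ha'⟩ ⟨hb, hb'⟩
    refine ⟨Submodule.add_mem _ ha hb, fun w hw => ?_⟩
    obtain ⟨m, hm⟩ := ha' w hw
    obtain ⟨n, hn⟩ := hb' w hw
    exact ⟨m + n, by rw [inner_add_left, hm, hn]; push_cast; rfl⟩
  smul_mem' := by
    rintro r a ⟨ha, ha'⟩
    refine ⟨zsmul_mem ha r, fun w hw => ?_⟩
    obtain ⟨m, hm⟩ := ha' w hw
    exact ⟨r * m, by rw [← Int.cast_smul_eq_zsmul ℝ, inner_smul_left, hm]; simp⟩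

/-! ### The central extension `Λ̂` and standard lifts -/

theorem scaledEmb_injective : Function.Injective scaledEmb := by
  intro x y h
  funext i
  have h1 : (x i : ℝ) / √8 = (y i : ℝ) / √8 := congrArg (fun v : Space => v i) h
  have h2 : (√8 : ℝ) ≠ 0 := by positivity
  have h3 : (x i : ℝ) = y i := by field_simp at h1; exact h1
  exact_mod_cast h3

/-- The lattice `Λ` and its integral model. -/
def leechEquiv : leechInt ≃ₗ[ℤ] leech :=
  Submodule.equivMapOfInjective scaledEmb scaledEmb_injective leechInt

instance : Module.Free ℤ leech := Module.Free.of_equiv leechEquiv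

instance : Module.Finite ℤ leech := Module.Finite.equiv leechEquiv

/-- The inner product of two vectors of `Λ`, as an integer. -/
def pairing (x y : leech) : ℤ := ⌊(inner ℝ (x : Space) (y : Space) : ℝ)⌋

/-- A `ℤ`-basis of `Λ`. -/
def leechBasis : Module.Basis (Fin (Module.finrank ℤ leech)) ℤ leech := Module.finBasis ℤ leech

/-- The exponent of the 2-cocycle: the `ℤ`-bilinear map on `Λ` whose value at the basis vectors
`(b i, b j)` is `⟨b i, b j⟩` if `j < i` and `0` otherwise. -/
def cocycleExp (x y : leech) : ℤ :=
  ∑ i, ∑ j, if j < i then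
    leechBasis.repr x i * leechBasis.repr y j * pairing (leechBasis i) (leechBasis j) else 0

/-! ### The Leech lattice is integral and even -/

theorem leechInt_dot {x y : Fin 24 → ℤ} (hx : x ∈ leechInt) (hy : y ∈ leechInt) :
    (8 : ℤ) ∣ ∑ i, x i * y i := by
  obtain ⟨m, c, hc, hx, s, hs⟩ := hx
  obtain ⟨n, d, hd, hy, t, ht⟩ := hy
  obtain ⟨u, hu⟩ := even_sum_mul hc hd
  simp only [hx, Finset.sum_add_distrib, ← Finset.mul_sum, Finset.sum_const, Finset.card_univ,
    Fintype.card_fin, nsmul_eq_mul] at hs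
  simp only [hy, Finset.sum_add_distrib, ← Finset.mul_sum, Finset.sum_const, Finset.card_univ,
    Fintype.card_fin, nsmul_eq_mul] at ht
  have : ∑ i, x i * y i = 24 * (m * n) + 2 * m * ∑ i, d i + 2 * n * ∑ i, c i +
      4 * ∑ i, c i * d i := by
    rw [show (24 : ℤ) * (m * n) = ∑ _i : Fin 24, m * n by simp]
    simp only [Finset.mul_sum, ← Finset.sum_add_distrib, hx, hy]
    exact Finset.sum_congr rfl fun i _ => by ring
  refine ⟨m * t + n * s + u - 2 * (m * n), ?_⟩
  push_cast at hs ht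
  rw [this, hu]
  linear_combination m * ht + n * hs

theorem leechInt_dot_self {x : Fin 24 → ℤ} (hx : x ∈ leechInt) : (16 : ℤ) ∣ ∑ i, x i * x i := by
  obtain ⟨m, c, hc, hx, s, hs⟩ := hx
  obtain ⟨u, hu⟩ := four_dvd_sum_sq hc
  simp only [hx, Finset.sum_add_distrib, ← Finset.mul_sum, Finset.sum_const, Finset.card_univ,
    Fintype.card_fin, nsmul_eq_mul] at hs
  have : ∑ i, x i * x i = 24 * m ^ 2 + 4 * m * ∑ i, c i + 4 * ∑ i, c i ^ 2 := by
    rw [show (24 : ℤ) * m ^ 2 = ∑ _i : Fin 24, m ^ 2 by simp]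
    simp only [Finset.mul_sum, ← Finset.sum_add_distrib, hx]
    exact Finset.sum_congr rfl fun i _ => by ring
  refine ⟨m * s - m ^ 2 + u, ?_⟩
  push_cast at hs
  rw [this, hu]
  linear_combination 2 * m * hs

theorem inner_scaledEmb (x y : Fin 24 → ℤ) :
    inner ℝ (scaledEmb x) (scaledEmb y) = ((∑ i, x i * y i : ℤ) : ℝ) / 8 := by
  rw [PiLp.inner_apply, Int.cast_sum, Finset.sum_div]
  refine Finset.sum_congr rfl fun i _ => ?_
  have h8 : (√8 : ℝ) * √8 = 8 := Real.mul_self_sqrt (by norm_num)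
  change (y i : ℝ) / √8 * (starRingEnd ℝ) ((x i : ℝ) / √8) = _
  rw [conj_trivial, div_mul_div_comm, h8]
  push_cast
  ring

theorem pairing_cast (x y : leech) : (pairing x y : ℝ) = inner ℝ (x : Space) (y : Space) := by
  obtain ⟨_, a, ha, rfl⟩ := x
  obtain ⟨_, b, hb, rfl⟩ := y
  obtain ⟨k, hk⟩ := leechInt_dot ha hb
  have h : inner ℝ (scaledEmb a) (scaledEmb b) = (k : ℝ) := by
    rw [inner_scaledEmb, hk]; push_cast; ring
  simp only [pairing]
  rw [h, Int.floor_intCast]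

theorem two_dvd_pairing_self (x : leech) : 2 ∣ pairing x x := by
  have h1 := pairing_cast x x
  obtain ⟨_, a, ha, rfl⟩ := x
  obtain ⟨k, hk⟩ := leechInt_dot_self ha
  refine ⟨k, ?_⟩
  rw [inner_scaledEmb, hk] at h1
  have h2 : (pairing ⟨scaledEmb a, ⟨a, ha, rfl⟩⟩ ⟨scaledEmb a, ⟨a, ha, rfl⟩⟩ : ℝ)
      = ((2 * k : ℤ) : ℝ) := by
    rw [h1]; push_cast; ring
  exact_mod_cast h2

theorem pairing_comm (x y : leech) : pairing x y = pairing y x := by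
  simp only [pairing, real_inner_comm]

theorem pairing_eq_sum (x y : leech) : pairing x y =
    ∑ i, ∑ j, leechBasis.repr x i * leechBasis.repr y j *
      pairing (leechBasis i) (leechBasis j) := by
  have key : ∀ z : leech, (z : Space) =
      ∑ i, (leechBasis.repr z i : ℝ) • (leechBasis i : Space) := by
    intro z
    conv_lhs => rw [← leechBasis.sum_repr z]
    rw [Submodule.coe_sum]
    refine Finset.sum_congr rfl fun i _ => ?_
    rw [Submodule.coe_smul, Int.cast_smul_eq_zsmul]
  have h : (pairing x y : ℝ) = ((∑ i, ∑ j, leechBasis.repr x i * leechBasis.repr y j *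
      pairing (leechBasis i) (leechBasis j) : ℤ) : ℝ) := by
    rw [pairing_cast, key x, key y, sum_inner]
    push_cast
    refine Finset.sum_congr rfl fun i _ => ?_
    rw [inner_sum]
    refine Finset.sum_congr rfl fun j _ => ?_
    rw [inner_smul_left, inner_smul_right, pairing_cast, conj_trivial]
    ring
  exact_mod_cast h

theorem cocycleExp_comm (x y : leech) : 2 ∣ cocycleExp x y + cocycleExp y x - pairing x y := by
  have hswap : cocycleExp y x = ∑ i, ∑ j, if i < j then
      leechBasis.repr x i * leechBasis.repr y j * pairing (leechBasis i) (leechBasis j)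
      else 0 := by
    rw [cocycleExp, Finset.sum_comm]
    refine Finset.sum_congr rfl fun i _ => Finset.sum_congr rfl fun j _ => ?_
    split_ifs
    · rw [pairing_comm]; ring
    · rfl
  rw [hswap, pairing_eq_sum, cocycleExp, ← Finset.sum_add_distrib, ← Finset.sum_sub_distrib]
  refine Finset.dvd_sum fun i _ => ?_
  rw [← Finset.sum_add_distrib, ← Finset.sum_sub_distrib]
  refine Finset.dvd_sum fun j _ => ?_
  rcases lt_trichotomy i j with h | h | h
  · simp [h, h.not_gt]
  · subst h
    simpa using (two_dvd_pairing_self (leechBasis i)).mul_left _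
  · simp [h, h.not_gt]

theorem cocycleExp_add_left (x y z : leech) :
    cocycleExp (x + y) z = cocycleExp x z + cocycleExp y z := by
  simp only [cocycleExp, ← Finset.sum_add_distrib]
  refine Finset.sum_congr rfl fun i _ => Finset.sum_congr rfl fun j _ => ?_
  split_ifs
  · simp only [map_add, Finsupp.add_apply]; ring
  · simp

theorem cocycleExp_add_right (x y z : leech) :
    cocycleExp x (y + z) = cocycleExp x y + cocycleExp x z := by
  simp only [cocycleExp, ← Finset.sum_add_distrib]
  refine Finset.sum_congr rfl fun i _ => Finset.sum_congr rfl fun j _ => ?_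
  split_ifs
  · simp only [map_add, Finsupp.add_apply]; ring
  · simp

/-- The 2-cocycle `ε : Λ × Λ → {±1}`. -/
def cocycle (x y : leech) : ℤˣ := (-1) ^ cocycleExp x y

theorem cocycle_add_left (x y z : leech) : cocycle (x + y) z = cocycle x z * cocycle y z := by
  rw [cocycle, cocycleExp_add_left, zpow_add]; rfl

theorem cocycle_add_right (x y z : leech) : cocycle x (y + z) = cocycle x y * cocycle x z := by
  rw [cocycle, cocycleExp_add_right, zpow_add]; rfl

theorem cocycle_zero_left (x : leech) : cocycle 0 x = 1 := by simp [cocycle, cocycleExp]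

theorem cocycle_zero_right (x : leech) : cocycle x 0 = 1 := by simp [cocycle, cocycleExp]

theorem cocycle_neg_left (x y : leech) : cocycle (-x) y = (cocycle x y)⁻¹ := by
  rw [eq_inv_iff_mul_eq_one, ← cocycle_add_left, neg_add_cancel, cocycle_zero_left]

/-- The central extension `1 → {±1} → Λ̂ → Λ → 1` with commutator map `(-1) ^ ⟨α, β⟩`. The element
`⟨s, α⟩` is `s e^α`, and `e^α e^β = ε(α, β) e^(α + β)`. -/
@[ext]
structure LeechHat where
  sign : ℤˣ
  vec : leech

instance : Mul LeechHat := ⟨fun a b => ⟨a.sign * b.sign * cocycle a.vec b.vec, a.vec + b.vec⟩⟩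

instance : One LeechHat := ⟨⟨1, 0⟩⟩

instance : Inv LeechHat := ⟨fun a => ⟨a.sign⁻¹ * cocycle a.vec a.vec, -a.vec⟩⟩

theorem LeechHat.mul_def (a b : LeechHat) :
    a * b = ⟨a.sign * b.sign * cocycle a.vec b.vec, a.vec + b.vec⟩ := rfl

theorem LeechHat.one_def : (1 : LeechHat) = ⟨1, 0⟩ := rfl

theorem LeechHat.inv_def (a : LeechHat) :
    a⁻¹ = ⟨a.sign⁻¹ * cocycle a.vec a.vec, -a.vec⟩ := rfl

instance : Group LeechHat :=
  Group.ofLeftAxioms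
    (by
      intro a b c
      simp only [LeechHat.mul_def, cocycle_add_left, cocycle_add_right, add_assoc]
      congr 1
      ac_rfl)
    (by intro a; ext <;> simp [LeechHat.mul_def, LeechHat.one_def, cocycle_zero_left])
    (by
      intro a
      simp only [LeechHat.mul_def, LeechHat.one_def, LeechHat.inv_def, cocycle_neg_left]
      congr 1
      · rw [mul_right_comm a.sign⁻¹, inv_mul_cancel, one_mul, mul_inv_cancel]
      · exact neg_add_cancel _)

/-- The commutator relation of `Λ̂`. -/
theorem LeechHat.commutator (a b : LeechHat) :
    a * b = ⟨(-1) ^ pairing a.vec b.vec, 0⟩ * (b * a) := by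
  obtain ⟨k, hk⟩ := cocycleExp_comm a.vec b.vec
  have h : pairing a.vec b.vec =
      cocycleExp a.vec b.vec + cocycleExp b.vec a.vec - 2 * k := by omega
  have h2 : ∀ n : ℤ, ((-1 : ℤˣ) ^ n) * (-1) ^ n = 1 := fun n => by
    rw [← mul_zpow]; simp
  ext1
  · simp only [LeechHat.mul_def, cocycle_zero_left, mul_one]
    rw [h, zpow_sub, zpow_add, zpow_mul, show ((-1 : ℤˣ) ^ (2 : ℤ)) = 1 by decide, one_zpow,
      inv_one, mul_one]
    change _ = cocycle a.vec b.vec * cocycle b.vec a.vec * (b.sign * a.sign * cocycle b.vec a.vec)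
    have h3 : cocycle b.vec a.vec * cocycle b.vec a.vec = 1 := h2 _
    calc a.sign * b.sign * cocycle a.vec b.vec
        = (b.sign * a.sign * cocycle a.vec b.vec) *
          (cocycle b.vec a.vec * cocycle b.vec a.vec) := by
          rw [h3, mul_one, mul_comm a.sign]
      _ = _ := by ac_rfl
  · simp only [LeechHat.mul_def]
    rw [zero_add, add_comm]

/-- `g` is a standard lift of `τ`: an automorphism of `Λ̂` that induces `τ` on `Λ` and fixes every
`e^α` with `α` in `Λ^τ` (hence every element of `Λ̂` above `Λ^τ`). Its order is `orderOf g`. -/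
def IsStandardLift (τ : Co0) (g : MulAut LeechHat) : Prop :=
  (∀ a : LeechHat, ((g a).vec : Space) = (τ : Space ≃ₗᵢ[ℝ] Space) (a.vec : Space)) ∧
    ∀ α : leech, (α : Space) ∈ fixedLattice τ → g ⟨1, α⟩ = ⟨1, α⟩

/-! ### The conjugacy classes -/

/-- The isometry of `Space` permuting the coordinates: the standard basis vector with index `i` is
sent to the one with index `π i`. -/
def permIso (π : Equiv.Perm (Fin 24)) : Space ≃ₗᵢ[ℝ] Space :=
  LinearIsometryEquiv.piLpCongrLeft 2 ℝ ℝ π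

theorem permIso_apply (π : Equiv.Perm (Fin 24)) (v : Space) (i : Fin 24) :
    permIso π v i = v (π.symm i) := rfl

/-- The isometry of `Space` changing the signs of the coordinates with index in `D`. -/
def signIso (D : Finset (Fin 24)) : Space ≃ₗᵢ[ℝ] Space where
  toFun v := WithLp.toLp 2 (fun i => if i ∈ D then -v i else v i)
  invFun v := WithLp.toLp 2 (fun i => if i ∈ D then -v i else v i)
  map_add' v w := by
    ext i
    by_cases h : i ∈ D <;> simp [h, add_comm]
  map_smul' r v := by
    ext i
    by_cases h : i ∈ D <;> simp [h]
  left_inv v := by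
    ext i
    by_cases h : i ∈ D <;> simp [h]
  right_inv v := by
    ext i
    by_cases h : i ∈ D <;> simp [h]
  norm_map' v := by
    rw [EuclideanSpace.norm_eq, EuclideanSpace.norm_eq]
    congr 1
    refine Finset.sum_congr rfl fun i _ => ?_
    by_cases h : i ∈ D <;> simp [h]

theorem signIso_apply (D : Finset (Fin 24)) (v : Space) (i : Fin 24) :
    signIso D v i = if i ∈ D then -v i else v i := rfl

theorem permIso_mem_leech {π : Equiv.Perm (Fin 24)}
    (h : ∀ k : Fin 12, (fun i => golayRow k (π.symm i)) ∈ golayCode) {v : Space}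
    (hv : v ∈ leech) : permIso π v ∈ leech := by
  have hπ : ∀ c ∈ golayCode, (fun i => c (π.symm i)) ∈ golayCode := by
    intro c hc
    have h1 : (fun i => c (π.symm i)) =
        ∑ k : Fin 12, c (Fin.castAdd 12 k) • (fun i => golayRow k (π.symm i)) := by
      funext i
      conv_lhs => rw [eq_sum_golayRow hc]
      simp [Finset.sum_apply]
    rw [h1]
    exact golayCode.sum_mem fun k _ => golayCode.smul_mem _ (h k)
  obtain ⟨x, ⟨m, c, hc, hx, hs⟩, rfl⟩ := hv
  refine ⟨fun i => x (π.symm i), ⟨m, fun i => c (π.symm i), hπ _ hc, fun i => hx _, ?_⟩, ?_⟩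
  · rwa [Equiv.sum_comp π.symm x]
  · ext i; rfl

theorem permIso_mem_Co0 {π : Equiv.Perm (Fin 24)}
    (h : ∀ k : Fin 12, (fun i => golayRow k (π.symm i)) ∈ golayCode)
    (h' : ∀ k : Fin 12, (fun i => golayRow k (π i)) ∈ golayCode) : permIso π ∈ Co0 := by
  intro v
  refine ⟨fun hv => ?_, permIso_mem_leech h⟩
  have h1 := permIso_mem_leech (π := π.symm) (by simpa using h') hv
  have h2 : permIso π.symm (permIso π v) = v := by
    ext i; simp [permIso_apply]
  rwa [h2] at h1

theorem signIso_mem_leech {D : Finset (Fin 24)}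
    (hD : (fun i => if i ∈ D then (1 : ZMod 2) else 0) ∈ golayCode) {v : Space}
    (hv : v ∈ leech) : signIso D v ∈ leech := by
  obtain ⟨x, ⟨m, c, hc, hx, hs⟩, rfl⟩ := hv
  have hD' : (fun i => (((if i ∈ D then 1 else 0 : ℤ)) : ZMod 2)) ∈ golayCode := by
    simpa using hD
  refine ⟨fun i => if i ∈ D then -x i else x i,
    ⟨m, fun i => c i - (if i ∈ D then 1 else 0) * (2 * c i + m), ?_, ?_, ?_⟩, ?_⟩
  · have := golayCode.add_mem hc (golayCode.smul_mem (m : ZMod 2) hD)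
    convert this using 1
    funext i
    have h2 : (2 : ZMod 2) = 0 := by decide
    by_cases h : i ∈ D <;> simp [h, h2, CharTwo.sub_eq_add]
  · intro i
    by_cases h : i ∈ D
    · simp only [h, if_true, hx i]; ring
    · simp only [h, if_false, hx i]; ring
  · obtain ⟨u, hu⟩ := even_sum_mul hc hD'
    obtain ⟨w, hw⟩ := four_dvd_sum_sq hD'
    obtain ⟨s, hs⟩ := hs
    have h1 : ∑ i, (if i ∈ D then -x i else x i) = ∑ i, x i -
        4 * (∑ i, c i * (if i ∈ D then 1 else 0)) -
        2 * m * ∑ i, (if i ∈ D then 1 else 0 : ℤ) ^ 2 := by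
      simp only [Finset.mul_sum, ← Finset.sum_sub_distrib]
      refine Finset.sum_congr rfl fun i _ => ?_
      by_cases h : i ∈ D
      · simp only [h, if_true, hx i]; ring
      · simp [h]
    rw [h1, hu, hw]
    exact ⟨s - u - m * w, by linear_combination hs⟩
  · ext i
    rw [signIso_apply]
    change ((if i ∈ D then -x i else x i : ℤ) : ℝ) / √8 =
      if i ∈ D then -((x i : ℝ) / √8) else (x i : ℝ) / √8
    split_ifs
    · push_cast; ring
    · rfl

theorem signIso_mem_Co0 {D : Finset (Fin 24)}
    (hD : (fun i => if i ∈ D then (1 : ZMod 2) else 0) ∈ golayCode) : signIso D ∈ Co0 := by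
  intro v
  refine ⟨fun hv => ?_, signIso_mem_leech hD⟩
  have h1 := signIso_mem_leech hD hv
  rwa [show signIso D (signIso D v) = v from (signIso D).left_inv v] at h1

/-- The names of the eleven conjugacy classes of `Co_0`. -/
inductive ClassName : Type
  | c1A | c2A | c2C | c3B | c4C | c5B | c6E | c6G | c7B | c8E | c10F

/-- The permutation part of a representative, as a product of disjoint cycles. -/
def ClassName.perm : ClassName → Equiv.Perm (Fin 24)
  | c1A => 1
  | c2A => c[1, 11] * c[2, 21] * c[3, 18] * c[4, 6] * c[8, 10] * c[9, 15] * c[12, 13] * c[17, 23]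
  | c2C => c[0, 23] * c[1, 13] * c[2, 17] * c[3, 5] * c[4, 12] * c[6, 11] * c[7, 21] * c[8, 22] *
      c[9, 15] * c[10, 18] * c[14, 16] * c[19, 20]
  | c3B => c[0, 2, 8] * c[1, 18, 5] * c[4, 20, 13] * c[6, 10, 7] * c[11, 19, 16] * c[17, 21, 22]
  | c4C => c[5, 20] * c[19, 22] * c[1, 13, 11, 12] * c[2, 18, 21, 3] * c[4, 15, 6, 9] *
      c[8, 17, 10, 23]
  | c5B => c[0, 22, 20, 11, 16] * c[1, 17, 7, 5, 10] * c[2, 21, 3, 18, 13] * c[6, 14, 23, 8, 19]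
  | c6E => c[3, 9] * c[12, 15] * c[6, 7, 10] * c[11, 16, 19] * c[0, 4, 2, 20, 8, 13] *
      c[1, 22, 18, 17, 5, 21]
  | c6G => c[0, 2, 8] * c[1, 18, 5] * c[4, 20, 13] * c[6, 10, 7] * c[11, 19, 16] * c[17, 21, 22]
  | c7B => c[0, 8, 22, 11, 2, 10, 3] * c[1, 5, 16, 18, 13, 21, 6] * c[7, 17, 19, 14, 15, 20, 23]
  | c8E => c[7, 16] * c[5, 19, 20, 22] * c[1, 21, 13, 3, 11, 2, 12, 18] *
      c[4, 10, 15, 23, 6, 8, 9, 17]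
  | c10F => c[4, 12] * c[9, 15] * c[0, 6, 22, 14, 20, 23, 11, 8, 16, 19] *
      c[1, 3, 17, 18, 7, 13, 5, 2, 10, 21]

/-- The set of coordinates whose sign is changed by a representative. It is non-empty only for `6G`,
where it consists of three of the six fixed points and three of the six 3-cycles. -/
def ClassName.signs : ClassName → Finset (Fin 24)
  | c6G => {1, 4, 5, 12, 13, 14, 17, 18, 20, 21, 22, 23}
  | _ => ∅

theorem ClassName.perm_mem (n : ClassName) : permIso n.perm ∈ Co0 := by
  apply permIso_mem_Co0
  · cases n <;> decide +kernel
  · cases n <;> decide +kernel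

theorem ClassName.signs_mem (n : ClassName) : signIso n.signs ∈ Co0 := by
  apply signIso_mem_Co0
  cases n <;> decide +kernel

/-- A representative of each of the conjugacy classes, a (signed) permutation of the coordinates.
The frame shapes of the representatives are
`1A : 1^24`, `2A : 1^8 2^8`, `2C : 2^12`, `3B : 1^6 3^6`, `4C : 1^4 2^2 4^4`, `5B : 1^4 5^4`,
`6E : 1^2 2^2 3^2 6^2`, `6G : 2^3 6^3`, `7B : 1^3 7^3`, `8E : 1^2 2 4 8^2`, `10F : 2^2 10^2`,
where the shape `∏ k^(a k)` means that the characteristic polynomial is `∏ (X^k - 1)^(a k)`. In all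
cases except `6G` this is the cycle shape of the permutation; for `6G` a 3-cycle with three sign
changes contributes `X^3 + 1` and a fixed point with a sign change contributes `X + 1`, which gives
`(X - 1)^3 (X + 1)^3 (X^3 - 1)^3 (X^3 + 1)^3 = (X^2 - 1)^3 (X^6 - 1)^3`. -/
def ClassName.rep (n : ClassName) : Co0 :=
  ⟨permIso n.perm * signIso n.signs, mul_mem n.perm_mem n.signs_mem⟩

/-- The set `P_0`, the union of the eleven conjugacy classes of `Co_0`. -/
def P0 : Set Co0 := {τ | ∃ n : ClassName, IsConj n.rep τ}

end LeechDuality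

/-! Two elements of `Λ̂` commute up to the sign given by their pairing, so the cocycle of the
extension differs from its transform under `τ` by a symmetric cocycle. It is a coboundary because
`Λ` is free, and splitting off `Λ^τ` makes the correcting signs trivial on `Λ^τ`: this gives a
standard lift.

Let `τ` have order `n`. Multiplying `a, g a, …, g ^ (n - 1) a` for a standard lift `g` shows that
`g ^ n` acts on the elements above `x` by `(-1) ^ ⟨x, x + τ x + ⋯ + τ ^ (n - 1) x⟩`, where the
exponent is `n` times the norm of the projection of `x` to the fixed space. Hence `|g|` is `n` or
`2n`, and it is `n` when `Λ^τ` is `n`-modular, since `Λ^τ` is even and the projection of `x` lies in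
`(Λ^τ)^*`.

The statement is invariant under conjugation, so that it suffices to exhibit, for one `τ` in each
class, a basis `b` of `Λ^τ` whose Gram matrix is, up to signs and reversal of the order, `ℓ` times
that of the dual basis. The dual basis is specified by vectors of `Λ` projecting to it; that these
project to a dual basis is the identity `x + τ x + ⋯ + τ ^ (n - 1) x = n ∑ i, ⟨d i, x⟩ b i`.
-/

namespace LeechDuality

open scoped InnerProductSpace

section FreeModules

theorem exists_projection_ker {R M N : Type*} [Ring R] [AddCommGroup M] [Module R M]
    [AddCommGroup N] [Module R N] (f : M →ₗ[R] N) [Module.Projective R f.range] :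
    ∃ p : M →ₗ[R] f.ker, ∀ x : f.ker, p x = x := by
  obtain ⟨s, hs⟩ := f.rangeRestrict.exists_rightInverse_of_surjective f.range_rangeRestrict
  have hs' (x : M) : f (s (f.rangeRestrict x)) = f x :=
    congrArg Subtype.val (LinearMap.congr_fun hs (f.rangeRestrict x))
  refine ⟨(LinearMap.id - s ∘ₗ f.rangeRestrict).codRestrict f.ker fun x => ?_,
    fun x => ?_⟩
  · have hx : f.rangeRestrict x = 0 := Subtype.ext x.2
    exact Subtype.ext (by simp [hx])
  · rw [LinearMap.mem_ker, LinearMap.sub_apply, map_sub, LinearMap.comp_apply, hs',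
      LinearMap.id_apply, sub_self]

/-- The central extension of `M` by `A` defined by a symmetric 2-cocycle `f`. It is abelian, so it
is written additively although `A` is multiplicative. -/
@[ext]
structure SymmExtension {M A : Type*} (f : M → M → A) where
  /-- The coordinate in the central subgroup. -/
  coeff : A
  /-- The image in the quotient. -/
  base : M

namespace SymmExtension

variable {M A : Type*} [AddCommGroup M] [CommGroup A] {f : M → M → A}

instance : Add (SymmExtension f) :=
  ⟨fun a b => ⟨a.coeff * b.coeff * f a.base b.base, a.base + b.base⟩⟩

instance : Zero (SymmExtension f) := ⟨⟨(f 0 0)⁻¹, 0⟩⟩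

instance : Neg (SymmExtension f) :=
  ⟨fun a => ⟨(a.coeff * f (-a.base) a.base * f 0 0)⁻¹, -a.base⟩⟩

theorem add_def (a b : SymmExtension f) :
    a + b = ⟨a.coeff * b.coeff * f a.base b.base, a.base + b.base⟩ := rfl

theorem zero_def : (0 : SymmExtension f) = ⟨(f 0 0)⁻¹, 0⟩ := rfl

theorem neg_def (a : SymmExtension f) :
    -a = ⟨(a.coeff * f (-a.base) a.base * f 0 0)⁻¹, -a.base⟩ := rfl

theorem map_zero_left (hf : ∀ x y z, f x y * f (x + y) z = f y z * f x (y + z)) (x : M) :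
    f 0 x = f 0 0 := by
  simpa using (hf 0 0 x).symm

/-- The group structure of the extension. -/
@[reducible]
def addCommGroup (hcomm : ∀ x y, f x y = f y x)
    (hf : ∀ x y z, f x y * f (x + y) z = f y z * f x (y + z)) :
    AddCommGroup (SymmExtension f) :=
  { AddGroup.ofLeftAxioms
      (fun a b c => by
        simp only [add_def, mk.injEq, add_assoc, and_true]
        have h := hf a.base b.base c.base
        calc _ = a.coeff * b.coeff * c.coeff *
              (f a.base b.base * f (a.base + b.base) c.base) := by ac_rfl
          _ = _ := by rw [h]; ac_rfl)
      (fun a => by ext <;> simp [add_def, zero_def, map_zero_left hf a.base])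
      (fun a => by
        ext
        · simp only [add_def, zero_def, neg_def]
          rw [mul_assoc, mul_inv, mul_right_comm, inv_mul_cancel, one_mul]
        · exact neg_add_cancel a.base) with
    add_comm := fun a b => by
      simp only [add_def, hcomm a.base, mul_comm a.coeff, add_comm a.base] }

end SymmExtension

theorem exists_coboundary_of_symm {M A : Type*} [AddCommGroup M] [Module.Projective ℤ M]
    [CommGroup A] {f : M → M → A} (hcomm : ∀ x y, f x y = f y x)
    (hf : ∀ x y z, f x y * f (x + y) z = f y z * f x (y + z)) :
    ∃ q : M → A, ∀ x y, q (x + y) = q x * q y * f x y := by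
  let _ := SymmExtension.addCommGroup hcomm hf
  let base : SymmExtension f →+ M := AddMonoidHom.mk' SymmExtension.base fun _ _ => rfl
  obtain ⟨s, hs⟩ := Module.projective_lifting_property base.toIntLinearMap LinearMap.id
    fun x => ⟨⟨1, x⟩, rfl⟩
  have hs' (x : M) : (s x).base = x := LinearMap.congr_fun hs x
  refine ⟨fun x => (s x).coeff, fun x y => ?_⟩
  calc (s (x + y)).coeff = (s x).coeff * (s y).coeff * f (s x).base (s y).base :=
        congrArg SymmExtension.coeff (map_add s x y)
    _ = (s x).coeff * (s y).coeff * f x y := by rw [hs', hs']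

end FreeModules

section Gram

variable {E F ι : Type*} [NormedAddCommGroup E] [InnerProductSpace ℝ E] [NormedAddCommGroup F]
  [InnerProductSpace ℝ F] {u : ι → E} {w : ι → F}

theorem inner_linearCombination_eq (h : ∀ i j, ⟪u i, u j⟫_ℝ = ⟪w i, w j⟫_ℝ) (x y : ι →₀ ℤ) :
    ⟪Finsupp.linearCombination ℤ u x, Finsupp.linearCombination ℤ u y⟫_ℝ =
      ⟪Finsupp.linearCombination ℤ w x, Finsupp.linearCombination ℤ w y⟫_ℝ := by
  simp only [Finsupp.linearCombination_apply, Finsupp.sum, sum_inner, inner_sum,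
    ← Int.cast_smul_eq_zsmul ℝ, real_inner_smul_left, real_inner_smul_right, h]

theorem ker_linearCombination_eq (h : ∀ i j, ⟪u i, u j⟫_ℝ = ⟪w i, w j⟫_ℝ) :
    (Finsupp.linearCombination ℤ u).ker = (Finsupp.linearCombination ℤ w).ker := by
  ext x
  rw [LinearMap.mem_ker, LinearMap.mem_ker, ← inner_self_eq_zero (𝕜 := ℝ),
    inner_linearCombination_eq h, inner_self_eq_zero]

theorem exists_span_equiv_of_inner_eq (h : ∀ i j, ⟪u i, u j⟫_ℝ = ⟪w i, w j⟫_ℝ) :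
    ∃ φ : Submodule.span ℤ (Set.range u) ≃ₗ[ℤ] Submodule.span ℤ (Set.range w),
      ∀ x y, ⟪(φ x : F), (φ y : F)⟫_ℝ = ⟪(x : E), (y : E)⟫_ℝ := by
  rw [← Finsupp.range_linearCombination, ← Finsupp.range_linearCombination]
  let φ := (Finsupp.linearCombination ℤ u).quotKerEquivRange.symm ≪≫ₗ
    Submodule.quotEquivOfEq _ _ (ker_linearCombination_eq h) ≪≫ₗ
    (Finsupp.linearCombination ℤ w).quotKerEquivRange
  have hφ (x : ι →₀ ℤ) : (φ ⟨Finsupp.linearCombination ℤ u x, x, rfl⟩ : F) =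
      Finsupp.linearCombination ℤ w x := by
    simp [φ, LinearMap.quotKerEquivRange_symm_apply_image _ x (LinearMap.mem_range_self _ x)]
  refine ⟨φ, ?_⟩
  rintro ⟨_, x, rfl⟩ ⟨_, y, rfl⟩
  rw [hφ, hφ, inner_linearCombination_eq h]

end Gram

section CyclicSum

variable {E : Type*} [NormedAddCommGroup E] [InnerProductSpace ℝ E]

/-- The sum `1 + g + ⋯ + g ^ (n - 1)`. When `g ^ n = 1`, it is `n` times the orthogonal projection
onto the vectors fixed by `g`. -/
def cyclicSum (g : E ≃ₗᵢ[ℝ] E) (n : ℕ) : E →ₗ[ℝ] E :=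
  ∑ k ∈ Finset.range n, (g ^ k).toLinearEquiv.toLinearMap

variable {g : E ≃ₗᵢ[ℝ] E} {n : ℕ}

theorem cyclicSum_apply (g : E ≃ₗᵢ[ℝ] E) (n : ℕ) (v : E) :
    cyclicSum g n v = ∑ k ∈ Finset.range n, (g ^ k) v := by
  simp [cyclicSum, LinearMap.sum_apply]

theorem apply_cyclicSum (hg : g ^ n = 1) (v : E) : g (cyclicSum g n v) = cyclicSum g n v := by
  have h := Finset.sum_range_succ' (fun k => (g ^ k) v) n
  rw [Finset.sum_range_succ, hg, pow_zero] at h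
  simpa only [cyclicSum_apply, map_sum, pow_succ', LinearIsometryEquiv.coe_mul,
    Function.comp_apply] using
    (add_right_cancel h).symm

theorem pow_apply_of_fixed {u : E} (hu : g u = u) (k : ℕ) : (g ^ k) u = u := by
  induction k with
  | zero => rfl
  | succ k ih => rw [pow_succ, LinearIsometryEquiv.coe_mul, Function.comp_apply, hu, ih]

theorem cyclicSum_of_fixed {u : E} (hu : g u = u) : cyclicSum g n u = (n : ℝ) • u := by
  simp [cyclicSum_apply, pow_apply_of_fixed hu, Nat.cast_smul_eq_nsmul]

theorem inner_cyclicSum_left {u : E} (hu : g u = u) (v : E) :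
    ⟪cyclicSum g n v, u⟫_ℝ = n * ⟪v, u⟫_ℝ := by
  have h (k : ℕ) : ⟪(g ^ k) v, u⟫_ℝ = ⟪v, u⟫_ℝ := by
    conv_lhs => rw [← pow_apply_of_fixed hu k, LinearIsometryEquiv.inner_map_map]
  simp [cyclicSum_apply, sum_inner, h]

end CyclicSum

section DualFrame

theorem span_range_units_smul_comp {ι M : Type*} [AddCommGroup M] (s : ι → ℤˣ)
    (e : Equiv.Perm ι) (b : ι → M) :
    Submodule.span ℤ (Set.range fun i => s i • b (e i)) = Submodule.span ℤ (Set.range b) := by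
  refine le_antisymm (Submodule.span_le.2 ?_) (Submodule.span_le.2 ?_) <;>
    rintro _ ⟨i, rfl⟩
  · exact Submodule.smul_mem _ (s i : ℤ) (Submodule.subset_span ⟨e i, rfl⟩)
  · have h : b i = (s (e.symm i) : ℤ) • s (e.symm i) • b (e (e.symm i)) := by
      rw [← Units.smul_def, smul_smul, Int.units_mul_self, one_smul, e.apply_symm_apply]
    rw [h]
    exact Submodule.smul_mem _ _ (Submodule.subset_span ⟨e.symm i, rfl⟩)

variable {ι : Type*} [Fintype ι] {L : Submodule ℤ Space} {b d : ι → Space}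

/-- The families `b` in `L` and `d` in the dual lattice of `L` form a resolution of the identity of
the real span of `L`. The vectors `b i` then generate `L` and the vectors `d i` its dual; this is
the description of a basis and its dual basis that does not mention linear independence. -/
structure IsDualFrame (L : Submodule ℤ Space) (b d : ι → Space) : Prop where
  mem (i : ι) : b i ∈ L
  mem_dual (i : ι) : d i ∈ dualLattice L
  expand {v : Space} (hv : v ∈ Submodule.span ℝ (L : Set Space)) : v = ∑ i, ⟪d i, v⟫_ℝ • b i

namespace IsDualFrame

theorem span_eq (h : IsDualFrame L b d) : Submodule.span ℤ (Set.range b) = L := by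
  refine le_antisymm (Submodule.span_le.2 (Set.range_subset_iff.2 h.mem)) fun v hv => ?_
  rw [h.expand (Submodule.subset_span hv)]
  refine Submodule.sum_mem _ fun i _ => ?_
  obtain ⟨m, hm⟩ := (h.mem_dual i).2 v hv
  rw [hm, Int.cast_smul_eq_zsmul]
  exact Submodule.smul_mem _ m (Submodule.subset_span ⟨i, rfl⟩)

theorem eq_sum_dual (h : IsDualFrame L b d) {v : Space}
    (hv : v ∈ Submodule.span ℝ (L : Set Space)) : v = ∑ i, ⟪v, b i⟫_ℝ • d i := by
  have hd : ∑ i, ⟪v, b i⟫_ℝ • d i ∈ Submodule.span ℝ (L : Set Space) :=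
    Submodule.sum_mem _ fun i _ => Submodule.smul_mem _ _ (h.mem_dual i).1
  have horth {w : Space} (hw : w ∈ Submodule.span ℝ (L : Set Space)) :
      ⟪v - ∑ i, ⟪v, b i⟫_ℝ • d i, w⟫_ℝ = 0 := by
    have hvw : ⟪v, w⟫_ℝ = ∑ i, ⟪d i, w⟫_ℝ * ⟪v, b i⟫_ℝ := by
      conv_lhs => rw [h.expand hw]
      simp only [inner_sum, real_inner_smul_right]
    rw [inner_sub_left, hvw, sum_inner, sub_eq_zero]
    exact Finset.sum_congr rfl fun i _ => by rw [real_inner_smul_left, mul_comm]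
  exact sub_eq_zero.1 (inner_self_eq_zero.1 (horth (Submodule.sub_mem _ hv hd)))

theorem span_dual_eq (h : IsDualFrame L b d) :
    Submodule.span ℤ (Set.range d) = dualLattice L := by
  refine le_antisymm (Submodule.span_le.2 (Set.range_subset_iff.2 h.mem_dual)) fun v hv => ?_
  rw [h.eq_sum_dual hv.1]
  refine Submodule.sum_mem _ fun i _ => ?_
  obtain ⟨m, hm⟩ := hv.2 (b i) (h.mem i)
  rw [hm, Int.cast_smul_eq_zsmul]
  exact Submodule.smul_mem _ m (Submodule.subset_span ⟨i, rfl⟩)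

end IsDualFrame

/-- `L` is `ℓ`-modular, that is, isometric to its dual lattice rescaled by `√ℓ`. -/
def IsModular (ℓ : ℕ) (L : Submodule ℤ Space) : Prop :=
  ∃ φ : (√(ℓ : ℝ) • dualLattice L : Submodule ℤ Space) ≃ₗ[ℤ] L,
    ∀ x y, ⟪(φ x : Space), (φ y : Space)⟫_ℝ = ⟪(x : Space), (y : Space)⟫_ℝ

theorem IsDualFrame.isModular (h : IsDualFrame L b d) {ℓ : ℕ} {s : ι → ℤˣ} {e : Equiv.Perm ι}
    (hgram : ∀ i j, ⟪s i • b (e i), s j • b (e j)⟫_ℝ = ℓ * ⟪d i, d j⟫_ℝ) : IsModular ℓ L := by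
  have hdual : Submodule.span ℤ (Set.range fun i => √(ℓ : ℝ) • d i) =
      √(ℓ : ℝ) • dualLattice L := by
    rw [← h.span_dual_eq, Submodule.smul_span, ← Set.range_smul]
  rw [IsModular, ← hdual, ← h.span_eq, ← span_range_units_smul_comp s e b]
  refine exists_span_equiv_of_inner_eq fun i j => ?_
  rw [hgram, real_inner_smul_left, real_inner_smul_right, ← mul_assoc,
    Real.mul_self_sqrt ℓ.cast_nonneg]

end DualFrame

section Conjugation

instance : DistribMulAction (Space ≃ₗᵢ[ℝ] Space) Space where
  smul σ v := σ v
  one_smul _ := rfl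
  mul_smul _ _ _ := rfl
  smul_zero σ := map_zero σ
  smul_add σ := map_add σ

instance : SMulCommClass (Space ≃ₗᵢ[ℝ] Space) ℝ Space := ⟨fun σ c v => map_smul σ c v⟩

theorem smul_mem_smul_iff {G R M : Type*} [Group G] [Semiring R] [AddCommMonoid M] [Module R M]
    [DistribMulAction G M] [SMulCommClass G R M] {g : G} {v : M} {S : Submodule R M} :
    g • v ∈ g • S ↔ v ∈ S :=
  Set.smul_mem_smul_set_iff

theorem smul_eq_apply (σ : Space ≃ₗᵢ[ℝ] Space) (v : Space) : σ • v = σ v := rfl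

theorem dualLattice_smul (σ : Space ≃ₗᵢ[ℝ] Space) (L : Submodule ℤ Space) :
    dualLattice (σ • L) = σ • dualLattice L := by
  have hspan : Submodule.span ℝ ((σ • L : Submodule ℤ Space) : Set Space) =
      σ • Submodule.span ℝ (L : Set Space) := by
    rw [Submodule.smul_span, Submodule.coe_pointwise_smul]
  ext v
  obtain ⟨v, rfl⟩ := σ.surjective v
  rw [← smul_eq_apply, smul_mem_smul_iff]
  refine and_congr ?_ ⟨fun h w hw => ?_, fun h w hw => ?_⟩
  · rw [hspan, smul_mem_smul_iff]
  · simpa only [smul_eq_apply, LinearIsometryEquiv.inner_map_map] using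
      h (σ • w) (Submodule.smul_mem_pointwise_smul w σ L hw)
  · obtain ⟨u, hu, rfl⟩ := (Submodule.mem_smul_pointwise_iff_exists w σ L).1 hw
    simpa only [smul_eq_apply, LinearIsometryEquiv.inner_map_map] using h u hu

theorem IsModular.smul {ℓ : ℕ} {L : Submodule ℤ Space} (h : IsModular ℓ L)
    (σ : Space ≃ₗᵢ[ℝ] Space) : IsModular ℓ (σ • L) := by
  obtain ⟨φ, hφ⟩ := h
  let σ' := DistribMulAction.toLinearEquiv ℤ Space σ
  have hdual : (√(ℓ : ℝ) • dualLattice L).map (σ' : Space →ₗ[ℤ] Space) =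
      √(ℓ : ℝ) • dualLattice (σ • L) := by
    rw [dualLattice_smul]
    exact SetLike.coe_injective (smul_comm σ √(ℓ : ℝ) (dualLattice L : Set Space))
  refine ⟨(σ'.ofSubmodules _ _ hdual).symm ≪≫ₗ φ ≪≫ₗ σ'.ofSubmodules L _ rfl, fun x y => ?_⟩
  obtain ⟨x, rfl⟩ := (σ'.ofSubmodules _ _ hdual).surjective x
  obtain ⟨y, rfl⟩ := (σ'.ofSubmodules _ _ hdual).surjective y
  simp only [LinearEquiv.trans_apply, LinearEquiv.symm_apply_apply]
  calc ⟪σ (φ x), σ (φ y)⟫_ℝ = ⟪σ x, σ y⟫_ℝ := by simp only [LinearIsometryEquiv.inner_map_map, hφ]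

theorem fixedLattice_conj (σ τ : Co0) :
    fixedLattice (σ * τ * σ⁻¹) = (σ : Space ≃ₗᵢ[ℝ] Space) • fixedLattice τ := by
  ext v
  obtain ⟨v, rfl⟩ := (σ : Space ≃ₗᵢ[ℝ] Space).surjective v
  rw [← smul_eq_apply, smul_mem_smul_iff]
  refine and_congr (σ.2 v) ?_
  have hconj : ((σ * τ * σ⁻¹ : Co0) : Space ≃ₗᵢ[ℝ] Space) ((σ : Space ≃ₗᵢ[ℝ] Space) v) =
      (σ : Space ≃ₗᵢ[ℝ] Space) ((τ : Space ≃ₗᵢ[ℝ] Space) v) :=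
    congrArg (fun w => (σ : Space ≃ₗᵢ[ℝ] Space) ((τ : Space ≃ₗᵢ[ℝ] Space) w))
      ((σ : Space ≃ₗᵢ[ℝ] Space).symm_apply_apply v)
  rw [smul_eq_apply, hconj, (σ : Space ≃ₗᵢ[ℝ] Space).injective.eq_iff]

end Conjugation

section FixedLattice

variable {τ : Co0} {n : ℕ}

theorem cyclicSum_mem_leech (τ : Co0) (n : ℕ) {v : Space} (hv : v ∈ leech) :
    cyclicSum (τ : Space ≃ₗᵢ[ℝ] Space) n v ∈ leech := by
  rw [cyclicSum_apply]
  exact Submodule.sum_mem _ fun k _ => ((τ ^ k).2 v).2 hv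

theorem cyclicSum_mem_fixedLattice (hτ : τ ^ n = 1) {v : Space} (hv : v ∈ leech) :
    cyclicSum (τ : Space ≃ₗᵢ[ℝ] Space) n v ∈ fixedLattice τ :=
  ⟨cyclicSum_mem_leech τ n hv, apply_cyclicSum (congrArg Subtype.val hτ) v⟩

theorem exists_inner_eq_intCast {v w : Space} (hv : v ∈ leech) (hw : w ∈ leech) :
    ∃ m : ℤ, ⟪v, w⟫_ℝ = m :=
  ⟨pairing ⟨v, hv⟩ ⟨w, hw⟩, (pairing_cast ⟨v, hv⟩ ⟨w, hw⟩).symm⟩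

theorem projection_mem_dualLattice (hτ : τ ^ n = 1) (hn : n ≠ 0) {v : Space} (hv : v ∈ leech) :
    (n : ℝ)⁻¹ • cyclicSum (τ : Space ≃ₗᵢ[ℝ] Space) n v ∈ dualLattice (fixedLattice τ) := by
  refine ⟨Submodule.smul_mem _ _ (Submodule.subset_span (cyclicSum_mem_fixedLattice hτ hv)),
    fun w hw => ?_⟩
  rw [real_inner_smul_left, inner_cyclicSum_left hw.2,
    inv_mul_cancel_left₀ (Nat.cast_ne_zero.2 hn)]
  exact exists_inner_eq_intCast hv hw.1

theorem apply_of_mem_span_fixedLattice {v : Space}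
    (hv : v ∈ Submodule.span ℝ (fixedLattice τ : Set Space)) :
    (τ : Space ≃ₗᵢ[ℝ] Space) v = v :=
  (Submodule.span_le (p := LinearMap.eqLocus (τ : Space ≃ₗᵢ[ℝ] Space).toLinearEquiv.toLinearMap
    LinearMap.id)).2 (fun _ hw => hw.2) hv

theorem isDualFrame_fixedLattice {ι : Type*} [Fintype ι] {b y : ι → Space} (hτ : τ ^ n = 1)
    (hn : n ≠ 0) (hb : ∀ i, b i ∈ fixedLattice τ) (hy : ∀ i, y i ∈ leech)
    (h : ∀ v, cyclicSum (τ : Space ≃ₗᵢ[ℝ] Space) n v =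
      ∑ i, ⟪cyclicSum (τ : Space ≃ₗᵢ[ℝ] Space) n (y i), v⟫_ℝ • b i) :
    IsDualFrame (fixedLattice τ) b
      fun i => (n : ℝ)⁻¹ • cyclicSum (τ : Space ≃ₗᵢ[ℝ] Space) n (y i) where
  mem := hb
  mem_dual i := projection_mem_dualLattice hτ hn (hy i)
  expand {v} hv := by
    have hn' : (n : ℝ) ≠ 0 := Nat.cast_ne_zero.2 hn
    simp only [real_inner_smul_left, mul_smul, ← Finset.smul_sum, ← h,
      cyclicSum_of_fixed (apply_of_mem_span_fixedLattice hv), inv_smul_smul₀ hn']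

end FixedLattice

section Action

instance : DistribMulAction Co0 leech where
  smul τ x := ⟨(τ : Space ≃ₗᵢ[ℝ] Space) (x : Space), (τ.2 x).2 x.2⟩
  one_smul _ := rfl
  mul_smul _ _ _ := rfl
  smul_zero τ := Subtype.ext (map_zero (τ : Space ≃ₗᵢ[ℝ] Space))
  smul_add τ x y := Subtype.ext (map_add (τ : Space ≃ₗᵢ[ℝ] Space) (x : Space) y)

theorem coe_smul (τ : Co0) (x : leech) :
    ((τ • x : leech) : Space) = (τ : Space ≃ₗᵢ[ℝ] Space) (x : Space) := rfl

theorem mem_fixedLattice_iff {τ : Co0} {x : leech} :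
    (x : Space) ∈ fixedLattice τ ↔ τ • x = x :=
  ⟨fun h => Subtype.ext h.2, fun h => ⟨x.2, congrArg Subtype.val h⟩⟩

theorem pairing_smul_smul (τ : Co0) (x y : leech) : pairing (τ • x) (τ • y) = pairing x y := by
  simp only [pairing, coe_smul, LinearIsometryEquiv.inner_map_map]

end Action

section Coordinates

theorem scaledEmb_apply (x : Fin 24 → ℤ) (a : Fin 24) : scaledEmb x a = (x a : ℝ) / √8 := rfl

theorem basisFun_eq_smul_scaledEmb (a : Fin 24) :
    EuclideanSpace.basisFun (Fin 24) ℝ a = √8 • scaledEmb (Pi.single a 1) := by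
  ext i
  rw [EuclideanSpace.basisFun_apply, PiLp.smul_apply, scaledEmb_apply, smul_eq_mul,
    mul_div_cancel₀ _ (by positivity)]
  by_cases h : i = a <;> simp [h]

theorem linearMap_ext_scaledEmb {f g : Space →ₗ[ℝ] Space}
    (h : ∀ a, f (scaledEmb (Pi.single a 1)) = g (scaledEmb (Pi.single a 1))) : f = g :=
  (EuclideanSpace.basisFun (Fin 24) ℝ).toBasis.ext fun a => by
    rw [OrthonormalBasis.coe_toBasis, basisFun_eq_smul_scaledEmb, map_smul, map_smul, h]

theorem Co0_ext {σ τ : Co0} (h : ∀ a, (σ : Space ≃ₗᵢ[ℝ] Space) (scaledEmb (Pi.single a 1)) =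
    (τ : Space ≃ₗᵢ[ℝ] Space) (scaledEmb (Pi.single a 1))) : σ = τ :=
  Subtype.ext <| LinearIsometryEquiv.ext <| LinearMap.congr_fun <| linearMap_ext_scaledEmb
    (f := (σ : Space ≃ₗᵢ[ℝ] Space).toLinearEquiv.toLinearMap)
    (g := (τ : Space ≃ₗᵢ[ℝ] Space).toLinearEquiv.toLinearMap) h

theorem mem_leechInt_iff (x : Fin 24 → ℤ) : x ∈ leechInt ↔
    (fun i => (((x i - x 0) / 2 : ℤ) : ZMod 2)) ∈ golayCode ∧
      (∀ i, 2 ∣ x i - x 0) ∧ 8 ∣ ∑ i, x i - 4 * x 0 := by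
  refine ⟨?_, fun ⟨hc, h2, h8⟩ =>
    ⟨x 0, _, hc, fun i => by rw [Int.mul_ediv_cancel' (h2 i)]; ring, h8⟩⟩
  rintro ⟨m, c, hc, hx, h8⟩
  have hsub (i : Fin 24) : x i - x 0 = 2 * (c i - c 0) := by rw [hx i, hx 0]; ring
  refine ⟨?_, fun i => ⟨_, hsub i⟩, ?_⟩
  · have hone : (1 : Fin 24 → ZMod 2) ∈ golayCode := by decide +kernel
    convert golayCode.sub_mem hc (golayCode.smul_mem (c 0 : ZMod 2) hone) using 1
    ext i
    simp [hsub]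
  · rw [show ∑ i, x i - 4 * x 0 = ∑ i, x i - 4 * m - 8 * c 0 by rw [hx 0]; ring]
    exact dvd_sub h8 ⟨_, rfl⟩

instance : DecidablePred (· ∈ leechInt) := fun x => decidable_of_iff _ (mem_leechInt_iff x).symm

theorem single_eight_mem_leechInt (a : Fin 24) : (Pi.single a 8 : Fin 24 → ℤ) ∈ leechInt := by
  refine ⟨0, Pi.single a 4, ?_, fun i => ?_, by simp⟩
  · convert golayCode.zero_mem using 1
    ext i
    by_cases hi : i = a
    · simp only [hi, Pi.single_eq_same]; rfl
    · simp [hi]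
  · by_cases hi : i = a <;> simp [hi]

instance : FaithfulSMul Co0 leech where
  eq_of_smul_eq_smul {σ τ} h := Co0_ext fun a => by
    have h8 : scaledEmb (Pi.single a 8) = (8 : ℝ) • scaledEmb (Pi.single a 1) := by
      rw [show (8 : ℝ) = (8 : ℤ) by norm_num, Int.cast_smul_eq_zsmul, ← map_zsmul,
        ← Pi.single_smul]
      rfl
    have h := congrArg Subtype.val
      (h ⟨_, Submodule.mem_map_of_mem (single_eight_mem_leechInt a)⟩)
    simpa only [coe_smul, h8, map_smul, smul_right_inj (by norm_num : (8 : ℝ) ≠ 0)] using h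

end Coordinates

section StandardLift

theorem cocycle_comm (x y : leech) : cocycle x y = (-1) ^ pairing x y * cocycle y x := by
  simpa [LeechHat.mul_def, cocycle_zero_left] using
    congrArg LeechHat.sign (LeechHat.commutator ⟨1, x⟩ ⟨1, y⟩)

theorem exists_sign_correction (τ : Co0) : ∃ h : leech → ℤˣ,
    (∀ x y, h (x + y) = h x * h y * (cocycle x y * cocycle (τ • x) (τ • y))) ∧
      ∀ x, τ • x = x → h x = 1 := by
  have hcomm (x y : leech) : cocycle x y * cocycle (τ • x) (τ • y) =
      cocycle y x * cocycle (τ • y) (τ • x) := by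
    rw [cocycle_comm x, cocycle_comm (τ • x), pairing_smul_smul, mul_mul_mul_comm,
      Int.units_mul_self, one_mul]
  obtain ⟨q, hq⟩ := exists_coboundary_of_symm
    (f := fun x y => cocycle x y * cocycle (τ • x) (τ • y)) hcomm fun x y z => by
      simp only [smul_add, cocycle_add_left, cocycle_add_right]
      ac_rfl
  let D : leech →ₗ[ℤ] leech := DistribSMul.toLinearMap ℤ leech τ - LinearMap.id
  have hD {x : leech} : x ∈ D.ker ↔ τ • x = x := sub_eq_zero
  obtain ⟨p, hp⟩ := exists_projection_ker D
  have hτp (x : leech) : τ • (p x : leech) = p x := hD.1 (p x).2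
  -- The cocycle equals `1` on the fixed sublattice, so `q` is a homomorphism there, and `q ∘ p`
  -- extends it to `leech`.
  refine ⟨fun x => q x * q (p x), fun x y => ?_, fun x hx => ?_⟩
  · have hpq : q (p x + p y) = q (p x) * q (p y) := by
      rw [hq, hτp, hτp, Int.units_mul_self, mul_one]
    simp only [map_add, Submodule.coe_add, hq x y, hpq]
    ac_rfl
  · have hpx : (p x : leech) = x := congrArg Subtype.val (hp ⟨x, hD.2 hx⟩)
    simp only [hpx, Int.units_mul_self]

theorem exists_isStandardLift (τ : Co0) : ∃ g : MulAut LeechHat, IsStandardLift τ g := by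
  obtain ⟨h, hadd, hfix⟩ := exists_sign_correction τ
  let g : MulAut LeechHat :=
    { toFun := fun a => ⟨a.sign * h a.vec, τ • a.vec⟩
      invFun := fun a => ⟨a.sign * h (τ⁻¹ • a.vec), τ⁻¹ • a.vec⟩
      left_inv := fun a => by simp [mul_assoc]
      right_inv := fun a => by simp [mul_assoc]
      map_mul' := fun a b => by
        simp only [LeechHat.mul_def, hadd, smul_add]
        congr 1
        calc _ = a.sign * b.sign * h a.vec * h b.vec * cocycle (τ • a.vec) (τ • b.vec) *
              (cocycle a.vec b.vec * cocycle a.vec b.vec) := by ac_rfl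
          _ = _ := by rw [Int.units_mul_self, mul_one]; ac_rfl }
  refine ⟨g, fun a => rfl, fun α hα => ?_⟩
  rw [mem_fixedLattice_iff] at hα
  exact LeechHat.ext (by simp [g, hfix α hα]) hα

theorem LeechHat.mk_zero_mul (s : ℤˣ) (a : LeechHat) : ⟨s, 0⟩ * a = ⟨s * a.sign, a.vec⟩ := by
  simp [LeechHat.mul_def, cocycle_zero_left]

theorem LeechHat.mk_zero_comm (s : ℤˣ) (a : LeechHat) : ⟨s, 0⟩ * a = a * ⟨s, 0⟩ := by
  simp [LeechHat.mul_def, cocycle_zero_left, cocycle_zero_right, mul_comm]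

namespace IsStandardLift

variable {σ τ : Co0} {g s : MulAut LeechHat}

theorem vec_apply (hg : IsStandardLift τ g) (a : LeechHat) : (g a).vec = τ • a.vec :=
  Subtype.ext (hg.1 a)

theorem apply_eq_self (hg : IsStandardLift τ g) {a : LeechHat} (ha : τ • a.vec = a.vec) :
    g a = a := by
  have hone : g ⟨1, a.vec⟩ = ⟨1, a.vec⟩ := hg.2 a.vec (mem_fixedLattice_iff.2 ha)
  have hvec : (g a).vec = a.vec := (hg.vec_apply a).trans ha
  rcases Int.units_eq_one_or a.sign with h1 | h1
  · rwa [show a = ⟨1, a.vec⟩ from LeechHat.ext h1 rfl]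
  rcases Int.units_eq_one_or (g a).sign with h2 | h2
  · have hga : g a = ⟨1, a.vec⟩ := LeechHat.ext h2 hvec
    have ha1 : a = ⟨1, a.vec⟩ := g.injective (hga.trans hone.symm)
    have hsign : (-1 : ℤˣ) = 1 := h1.symm.trans (congrArg LeechHat.sign ha1)
    exact absurd hsign (by decide)
  · exact LeechHat.ext (h2.trans h1.symm) hvec

theorem conj (hg : IsStandardLift (σ * τ * σ⁻¹) g) (hs : IsStandardLift σ s) :
    IsStandardLift τ (s⁻¹ * g * s) := by
  have hinv (a : LeechHat) : (s⁻¹ a).vec = σ⁻¹ • a.vec := by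
    rw [eq_inv_smul_iff, ← hs.vec_apply, MulAut.apply_inv_self]
  refine ⟨fun a => ?_, fun α hα => ?_⟩
  · have hvec : ((s⁻¹ * g * s) a).vec = τ • a.vec := calc
      (s⁻¹ (g (s a))).vec = σ⁻¹ • (σ * τ * σ⁻¹) • σ • a.vec := by
        rw [hinv, hg.vec_apply, hs.vec_apply]
      _ = τ • a.vec := by simp [mul_smul]
    exact congrArg Subtype.val hvec
  · have hfix : g (s ⟨1, α⟩) = s ⟨1, α⟩ := hg.apply_eq_self <| by
      rw [hs.vec_apply, mul_smul, mul_smul, inv_smul_smul, mem_fixedLattice_iff.1 hα]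
    rw [MulAut.mul_apply, MulAut.mul_apply, hfix, MulAut.inv_apply_self]

theorem vec_pow_apply (hg : IsStandardLift τ g) (k : ℕ) (a : LeechHat) :
    ((g ^ k) a).vec = τ ^ k • a.vec := by
  induction k with
  | zero => simp
  | succ k ih => rw [pow_succ', MulAut.mul_apply, hg.vec_apply, ih, pow_succ', mul_smul]

theorem pow_eq_one (hg : IsStandardLift τ g) {n : ℕ} (h : g ^ n = 1) : τ ^ n = 1 :=
  eq_of_smul_eq_smul fun x : leech => by
    rw [one_smul, ← hg.vec_pow_apply n ⟨1, x⟩, h, MulAut.one_apply]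

end IsStandardLift

theorem coe_sum_pow_smul (τ : Co0) (n : ℕ) (x : leech) :
    ((∑ k ∈ Finset.range n, τ ^ k • x : leech) : Space) =
      cyclicSum (τ : Space ≃ₗᵢ[ℝ] Space) n x := by
  rw [cyclicSum_apply, Submodule.coe_sum]
  rfl

/-- The inner product `⟨x, x + τ x + ⋯ + τ ^ (n - 1) x⟩`. When `τ ^ n = 1`, it is `n` times the
norm of the projection of `x` to the vectors fixed by `τ`. -/
def traceNorm (τ : Co0) (n : ℕ) (x : leech) : ℤ := pairing x (∑ k ∈ Finset.range n, τ ^ k • x)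

theorem traceNorm_cast (τ : Co0) (n : ℕ) (x : leech) :
    (traceNorm τ n x : ℝ) = ⟪(x : Space), cyclicSum (τ : Space ≃ₗᵢ[ℝ] Space) n x⟫_ℝ := by
  rw [traceNorm, pairing_cast, coe_sum_pow_smul]

theorem IsModular.even_traceNorm {τ : Co0} {n : ℕ} (hτ : τ ^ n = 1) (hn : n ≠ 0)
    (h : IsModular n (fixedLattice τ)) (x : leech) : Even (traceNorm τ n x) := by
  obtain ⟨φ, hφ⟩ := h
  have hn' : (n : ℝ) ≠ 0 := Nat.cast_ne_zero.2 hn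
  set T := cyclicSum (τ : Space ≃ₗᵢ[ℝ] Space) n
  have hxT : (traceNorm τ n x : ℝ) = ⟪(x : Space), T x⟫_ℝ := traceNorm_cast τ n x
  have hTT : ⟪T x, T x⟫_ℝ = n * ⟪(x : Space), T x⟫_ℝ :=
    inner_cyclicSum_left (apply_cyclicSum (congrArg Subtype.val hτ) _) _
  let y : (√(n : ℝ) • dualLattice (fixedLattice τ) : Submodule ℤ Space) :=
    ⟨√(n : ℝ) • (n : ℝ)⁻¹ • T x,
      Submodule.smul_mem_pointwise_smul _ _ _ (projection_mem_dualLattice hτ hn x.2)⟩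
  have hcast : (traceNorm τ n x : ℝ) = pairing ⟨φ y, (φ y).2.1⟩ ⟨φ y, (φ y).2.1⟩ :=
    calc (traceNorm τ n x : ℝ) = ⟪(y : Space), (y : Space)⟫_ℝ := by
          simp only [y, real_inner_smul_left, real_inner_smul_right, hTT, hxT]
          field_simp
          rw [Real.sq_sqrt n.cast_nonneg]
      _ = _ := by rw [← hφ, pairing_cast]
  rw [Int.cast_injective hcast]
  exact even_iff_two_dvd.2 (two_dvd_pairing_self _)

namespace IsStandardLift

variable {τ : Co0} {g : MulAut LeechHat}

theorem pow_apply (hg : IsStandardLift τ g) {n : ℕ} (hτ : τ ^ n = 1) (a : LeechHat) :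
    (g ^ n) a = ⟨(-1) ^ traceNorm τ n a.vec, 0⟩ * a := by
  -- `r` is the product of `a, g a, …, g ^ (n - 1) a`.
  have hprod (n : ℕ) : ∃ r : LeechHat, r.vec = ∑ k ∈ Finset.range n, τ ^ k • a.vec ∧
      r * (g ^ n) a = a * g r := by
    induction n with
    | zero => exact ⟨1, rfl, by simp⟩
    | succ n ih =>
      obtain ⟨r, hr, h⟩ := ih
      refine ⟨r * (g ^ n) a, ?_, ?_⟩
      · rw [Finset.sum_range_succ, ← hr, ← hg.vec_pow_apply, LeechHat.mul_def]
      · rw [map_mul, ← mul_assoc a, ← h, pow_succ', MulAut.mul_apply]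
  obtain ⟨r, hr, h⟩ := hprod n
  have hfix : τ • r.vec = r.vec := by
    rw [← mem_fixedLattice_iff, hr, coe_sum_pow_smul]
    exact cyclicSum_mem_fixedLattice hτ a.vec.2
  rw [hg.apply_eq_self hfix, LeechHat.commutator a r, ← mul_assoc, LeechHat.mk_zero_comm,
    mul_assoc] at h
  rw [mul_left_cancel h, hr, traceNorm]

theorem pow_eq_one_iff (hg : IsStandardLift τ g) {n : ℕ} (hτ : τ ^ n = 1) :
    g ^ n = 1 ↔ ∀ x, Even (traceNorm τ n x) := by
  refine ⟨fun h x => ?_, fun h => MulEquiv.ext fun a => ?_⟩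
  · have hx : (-1 : ℤˣ) ^ traceNorm τ n x * 1 = 1 := by
      have := congrArg LeechHat.sign (hg.pow_apply hτ ⟨1, x⟩)
      rw [h, LeechHat.mk_zero_mul] at this
      exact this.symm
    by_contra hodd
    rw [(Int.not_even_iff_odd.1 hodd).neg_one_zpow] at hx
    exact absurd hx (by decide)
  · rw [hg.pow_apply hτ, (h a.vec).neg_one_zpow]
    exact one_mul a

theorem orderOf_eq (hg : IsStandardLift τ g) (h : ∀ x, Even (traceNorm τ (orderOf τ) x)) :
    orderOf g = orderOf τ :=
  Nat.dvd_antisymm (orderOf_dvd_of_pow_eq_one ((hg.pow_eq_one_iff (pow_orderOf_eq_one τ)).2 h))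
    (orderOf_dvd_of_pow_eq_one (hg.pow_eq_one (pow_orderOf_eq_one g)))

theorem pow_two_mul_orderOf (hg : IsStandardLift τ g) : g ^ (2 * orderOf τ) = 1 := by
  refine MulEquiv.ext fun a => ?_
  have h := hg.pow_apply (pow_orderOf_eq_one τ)
  rw [two_mul, pow_add, MulAut.mul_apply, h, h, LeechHat.mk_zero_mul, LeechHat.mk_zero_mul,
    ← mul_assoc, Int.units_mul_self, one_mul, MulAut.one_apply]

theorem orderOf_eq_two_mul (hg : IsStandardLift τ g) (hτ : orderOf τ ≠ 0) {x : leech}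
    (hx : Odd (traceNorm τ (orderOf τ) x)) : orderOf g = 2 * orderOf τ := by
  have hne : orderOf g ≠ orderOf τ := fun h => Int.not_even_iff_odd.2 hx <|
    (hg.pow_eq_one_iff (pow_orderOf_eq_one τ)).1 (h ▸ pow_orderOf_eq_one g) x
  obtain ⟨m, hm⟩ := orderOf_dvd_of_pow_eq_one (hg.pow_eq_one (pow_orderOf_eq_one g))
  have h2 : orderOf τ * m ∣ orderOf τ * 2 := by
    rw [← hm, mul_comm]
    exact orderOf_dvd_of_pow_eq_one hg.pow_two_mul_orderOf
  rw [Nat.mul_dvd_mul_iff_left (Nat.pos_of_ne_zero hτ), Nat.dvd_prime Nat.prime_two] at h2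
  rcases h2 with rfl | rfl
  · exact absurd (hm.trans (mul_one _)) hne
  · rw [hm, mul_comm]

end IsStandardLift

end StandardLift

section Tables

/-- The integral vector encoded by the numeral `row`: the decimal digits of `row`, from the least
significant one on, are the entries increased by `4`. -/
def digitVec (row : ℕ) (a : Fin 24) : ℤ := (row / 10 ^ (a : ℕ) % 10 : ℕ) - 4

namespace ClassName

/-- The order of `n.rep`. -/
def period : ClassName → ℕ
  | c1A => 1 | c2A => 2 | c2C => 2 | c3B => 3 | c4C => 4 | c5B => 5
  | c6E => 6 | c6G => 6 | c7B => 7 | c8E => 8 | c10F => 10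

/-- The order of the standard lifts of `n.rep`. -/
def level : ClassName → ℕ
  | c2C => 4 | c6G => 12 | c10F => 20
  | n => n.period

/-- The action of `n.rep` in the coordinates of `leechInt`. -/
def act (n : ClassName) (x : Fin 24 → ℤ) (a : Fin 24) : ℤ :=
  if n.perm.symm a ∈ n.signs then -x (n.perm.symm a) else x (n.perm.symm a)

/-- The action of `cyclicSum n.rep n.period` in the coordinates of `leechInt`. -/
def trace (n : ClassName) (x : Fin 24 → ℤ) (a : Fin 24) : ℤ :=
  ∑ k ∈ Finset.range n.period, n.act^[k] x a

/-- A basis of the fixed-point lattice of `n.rep`, and vectors of the Leech lattice that project to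
its dual basis: the pairs `(basisVec i, dualVec i)`, encoded for `digitVec`. -/
def frameRows : ClassName → List (ℕ × ℕ)
  | c1A =>
    [(264444424444424464424422, 242444444424244422444422),
     (535533353333353335373553, 555535355135333535333353),
     (533533333355535315553535, 533753533555335553353535),
     (533555537533553553335353, 331355335333353333533553),
     (533335573353355555553533, 533513553355335553335353),
     (242446464444444666464444, 446446444444644446466224),
     (444626264644464444444644, 446424444444642644646644),
     (224444464444424424464466, 335313555535533533555333),
     (442444264646464646444444, 351333355335355333333353),
     (335533353355353155553533, 442242444644642262664644),
     (353335553353335535573555, 482444666444442224442444),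
     (753153335373535733533313, 446444444446644642664442),
     (553353535533353755355353, 533551533753333573353737),
     (155533315373533353333333, 555513555355533555333355),
     (355533513333353333375375, 444424444446446442466242),
     (444444244462624422244444, 462442464442644244446444),
     (553353513535533535335353, 555535553355531535535353),
     (644442624424464446444442, 355333555533755335555333),
     (553353535335335555735335, 553313355333533355535355),
     (644446444624644442224444, 553313555535533353353335),
     (444424242462444424462444, 333355333531353335533335),
     (244646464624444464444464, 555753553555535553553353),
     (644444246664444444424422, 555535555555335335355133),
     (353335333553515535353553, 424244224444446464444664)]
  | c2A =>
    [(446644444644464644644646, 444444644462264422644444),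
     (533553533555533315353353, 553533533353555135555555),
     (424646466244446444446444, 333535755535333355535355),
     (355533353555333333333537, 535333335555555333335315),
     (335535313333333353535533, 426444444444242264464464),
     (464224424644444464644442, 755533535573555353335313),
     (533551553755553535351355, 624444244644644464244424),
     (533375535333335335355333, 533353535555375331335513),
     (424624462266642422224462, 535335553533555335313533),
     (555355553355553553335557, 664664444444444262444464),
     (335737333355553533337553, 444444226464444646224444),
     (555155555555555555555555, 426244246464442444464444),
     (444644462466442424244444, 353555553337333555553533),
     (464246422644442444446444, 533335353551353333555355),
     (355555335733335335555533, 555555355551533353353553),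
     (333533333555533333533351, 242464444464464242644444)]
  | c2C =>
    [(464444444424244642242424, 353535353333535533551553),
     (246444444424644466444422, 335353335335753533335335),
     (642444446442446424424446, 444464444422426444642464),
     (666444444444444664242446, 626444444244644642444244),
     (244446424262464444626462, 446444242244244426424444),
     (246444444424244462444422, 337353533533335333533555),
     (244224246444246442646242, 446444426464444424464224),
     (642444444424244422444426, 624444444444462644644224),
     (642222444444424424444446, 335331535355353535533535),
     (444226446442466444424444, 553335355535553353335753),
     (622444444444444224242446, 624444226444442444244442),
     (444666624244464444444644, 533533537355553553355533)]
  | c3B =>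
    [(466464664644646444444444, 353575533535533355553335),
     (644446446246442444644464, 462246444444622444444644),
     (266444646246444444446444, 335535555353375335535335),
     (555553553351533333355333, 444446444422424246466444),
     (622444244444462466444444, 333535555533573335555533),
     (644644444262442444462444, 553551533355335555553355),
     (644464466446646444446444, 515535555555335335355533),
     (133535333553335533553555, 335555333575533553535335),
     (444426424644244444642464, 555533335553355553535155),
     (422446244444446444642464, 351555555333355353533333),
     (355533535353331333353333, 353355335555513355353333),
     (355553555551535533353535, 444244446422444244464646)]
  | c4C =>
    [(424224464244444424244446, 535533355337353553355535),
     (464264464644444464244446, 533357555555333555555355),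
     (533333515533355555353335, 624444642444444264464244),
     (444444446422246446464424, 446446244424646646444444),
     (464664464244444464644442, 333553553335153555333553),
     (464264424244444464244446, 553355533353355135335353),
     (535535533555553533535551, 646446644444464244446244),
     (464664424244444464644446, 446646444444446644422446),
     (444644444266644444644462, 444444446462646442464464),
     (355555333355533373535553, 446424442464226464444444)]
  | c5B =>
    [(244424442246444242464444, 535353353353355351353535),
     (464644464446646444464446, 355355553535535533535155),
     (555555353555533535375535, 355573533555353355355333),
     (333333333337333333333333, 424244444446644624644244),
     (535355535553357555535553, 555353335555155353553535),
     (533353533531355555533353, 642446642424444424644444),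
     (335335533355353353515553, 553535333535353553533755),
     (353533555335553353573355, 353355515535553335555355)]
  | c6E =>
    [(644464466446642444442444, 444444466424422444466442),
     (733533335355333533353535, 555533553335333555375533),
     (333333335135355355335333, 444424246444646244424446),
     (644464464644664466444444, 553333353555355155553555),
     (422442244444442444242424, 444442444442444244242662),
     (244464464244664466444444, 353533553335553535555337),
     (533553353753535533355535, 464444244444646442224644),
     (555355553133555355535353, 553533553333533353555135)]
  | c6G =>
    [(444424426444262266442242, 244624444244464444264464),
     (444444448444448444444444, 335335555335335353573555),
     (444444440444444444440444, 533555533531335335553533),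
     (444464466444666266442242, 444444464246424464244264),
     (444464462444666666442646, 442644444244464244244646),
     (444444444444440444440444, 533333355733533335353535)]
  | c7B =>
    [(533553535533331353333333, 535353315535353335535353),
     (533553535533335353373333, 353553553353535535353313),
     (535555555555335355573353, 333533555535533535753355),
     (335335353355337335533353, 335513335535355353533355),
     (553553535537555553355535, 446624424446624444244444),
     (244224242244442424444444, 333515535335333535555335)]
  | c8E =>
    [(535335535755555535355553, 264424446446464424244444),
     (424224464244444464244442, 355515553353335533335533),
     (555555555555555555555551, 264464446446464464244444),
     (533333555133355555353335, 733533353355335535555355),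
     (464664424244444424644442, 153355535335553533355333),
     (355555333355533333535557, 353355553335353535335575)]
  | c10F =>
    [(444444444440444444404444, 555335315353533535533335),
     (444444448444448444444444, 553533555355335355535515),
     (664664462644642646444446, 355533355375553535333535),
     (442442244426424424262224, 353355555555533333335133)]

/-- The rank of the fixed-point lattice of `n.rep`. -/
def rank (n : ClassName) : ℕ := n.frameRows.length

/-- The basis of the fixed-point lattice of `n.rep`, in the coordinates of `leechInt`. -/
def basisVec (n : ClassName) (i : Fin n.rank) : Fin 24 → ℤ := digitVec (n.frameRows.get i).1

/-- Vectors of `leechInt` whose projections to the space fixed by `n.rep` form the dual basis of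
`basisVec`. -/
def dualVec (n : ClassName) (i : Fin n.rank) : Fin 24 → ℤ := digitVec (n.frameRows.get i).2

/-- The signs `s i` for which `√ℓ • d i ↦ s i • basisVec i.rev` is an isometry, where `ℓ` is the
level and `d` the dual basis of `basisVec`. The bases have been chosen so that there is an isometry
of this form. -/
def revSign (n : ClassName) (i : Fin n.rank) : ℤˣ := if 2 * (i : ℕ) < n.rank then 1 else -1

theorem act_iterate_period_single (n : ClassName) :
    ∀ a' a, n.act^[n.period] (Pi.single a' 1) a = (Pi.single a' 1 : Fin 24 → ℤ) a := by
  cases n <;> decide +kernel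

theorem act_iterate_single_ne (n : ClassName) : ∀ m < n.period, 0 < m →
    ∃ a' a, n.act^[m] (Pi.single a' 1) a ≠ (Pi.single a' 1 : Fin 24 → ℤ) a := by
  cases n <;> decide +kernel

theorem dualVec_mem (n : ClassName) : ∀ i, n.dualVec i ∈ leechInt := by
  cases n <;> decide +kernel

theorem basisVec_mem (n : ClassName) : ∀ i, n.basisVec i ∈ leechInt := by
  cases n <;> decide +kernel

theorem act_basisVec (n : ClassName) : ∀ i a, n.act (n.basisVec i) a = n.basisVec i a := by
  cases n <;> decide +kernel

theorem eight_mul_trace_single (n : ClassName) : ∀ a a', 8 * n.trace (Pi.single a' 1) a =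
    ∑ i, n.basisVec i a * n.trace (n.dualVec i) a' := by
  cases n <;> decide +kernel

theorem basisVec_dot_basisVec (n : ClassName) : ∀ i j,
    n.period * ((n.revSign i : ℤ) * n.revSign j * ∑ a, n.basisVec i.rev a * n.basisVec j.rev a) =
      n.level * ∑ a, n.dualVec i a * n.trace (n.dualVec j) a := by
  cases n <;> decide +kernel

theorem level_eq_or (n : ClassName) : n.level = n.period ∨ n.level = 2 * n.period ∧
    ∃ i, (∑ a, n.dualVec i a * n.trace (n.dualVec i) a) % 16 = 8 := by
  cases n <;> decide +kernel

end ClassName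

end Tables

section Representatives

namespace ClassName

variable (n : ClassName)

theorem period_ne_zero : n.period ≠ 0 := by
  cases n <;> decide

theorem rep_scaledEmb (x : Fin 24 → ℤ) :
    (n.rep : Space ≃ₗᵢ[ℝ] Space) (scaledEmb x) = scaledEmb (n.act x) := by
  ext a
  change (if n.perm.symm a ∈ n.signs then -(scaledEmb x (n.perm.symm a))
    else scaledEmb x (n.perm.symm a)) = _
  rw [scaledEmb_apply, scaledEmb_apply, act]
  split_ifs
  · rw [Int.cast_neg, neg_div]
  · rfl

theorem rep_pow_scaledEmb (k : ℕ) (x : Fin 24 → ℤ) :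
    ((n.rep : Space ≃ₗᵢ[ℝ] Space) ^ k) (scaledEmb x) = scaledEmb (n.act^[k] x) := by
  induction k with
  | zero => rfl
  | succ k ih =>
    rw [pow_succ', LinearIsometryEquiv.coe_mul, Function.comp_apply, ih, rep_scaledEmb,
      Function.iterate_succ_apply']

theorem cyclicSum_scaledEmb (x : Fin 24 → ℤ) :
    cyclicSum (n.rep : Space ≃ₗᵢ[ℝ] Space) n.period (scaledEmb x) = scaledEmb (n.trace x) := by
  simp only [cyclicSum_apply, rep_pow_scaledEmb, ← map_sum]
  congr 1
  ext a
  exact Finset.sum_apply a _ _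

theorem orderOf_rep : orderOf n.rep = n.period := by
  refine (orderOf_eq_iff (Nat.pos_of_ne_zero n.period_ne_zero)).2
    ⟨Co0_ext fun a' => ?_, fun m hm h0 h => ?_⟩
  · rw [SubgroupClass.coe_pow, rep_pow_scaledEmb, funext (n.act_iterate_period_single a')]
    rfl
  · obtain ⟨a', a, ha⟩ := n.act_iterate_single_ne m hm h0
    refine ha (congrFun (scaledEmb_injective ?_) a)
    rw [← rep_pow_scaledEmb, ← SubgroupClass.coe_pow, h]
    rfl

theorem rep_pow_period : n.rep ^ n.period = 1 := by
  rw [← orderOf_rep, pow_orderOf_eq_one]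

theorem cyclicSum_eq_sum (v : Space) : cyclicSum (n.rep : Space ≃ₗᵢ[ℝ] Space) n.period v =
    ∑ i, ⟪cyclicSum (n.rep : Space ≃ₗᵢ[ℝ] Space) n.period (scaledEmb (n.dualVec i)), v⟫_ℝ •
      scaledEmb (n.basisVec i) := by
  have h : cyclicSum (n.rep : Space ≃ₗᵢ[ℝ] Space) n.period = ∑ i,
      (innerₗ Space (scaledEmb (n.trace (n.dualVec i)))).smulRight (scaledEmb (n.basisVec i)) := by
    refine linearMap_ext_scaledEmb fun a' => ?_
    ext a
    have hentry : (8 * n.trace (Pi.single a' 1) a : ℝ) =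
        ∑ i, (n.basisVec i a : ℝ) * n.trace (n.dualVec i) a' :=
      mod_cast n.eight_mul_trace_single a a'
    simp only [LinearMap.sum_apply, LinearMap.smulRight_apply, innerₗ_apply_apply,
      cyclicSum_scaledEmb, inner_scaledEmb, WithLp.ofLp_sum, WithLp.ofLp_smul, Finset.sum_apply,
      Pi.smul_apply, scaledEmb_apply, smul_eq_mul, Pi.single_apply, mul_ite, mul_one, mul_zero,
      Finset.sum_ite_eq', Finset.mem_univ, if_true]
    rw [← mul_right_inj' (show (8 : ℝ) ≠ 0 by norm_num), ← mul_div_assoc, hentry, Finset.sum_div,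
      Finset.mul_sum]
    exact Finset.sum_congr rfl fun i _ => by ring
  simp only [cyclicSum_scaledEmb]
  simp [h]

theorem isDualFrame : IsDualFrame (fixedLattice n.rep) (fun i => scaledEmb (n.basisVec i))
    fun i => (n.period : ℝ)⁻¹ •
      cyclicSum (n.rep : Space ≃ₗᵢ[ℝ] Space) n.period (scaledEmb (n.dualVec i)) :=
  isDualFrame_fixedLattice n.rep_pow_period n.period_ne_zero
    (fun i => ⟨Submodule.mem_map_of_mem (n.basisVec_mem i), by
      rw [rep_scaledEmb, funext (n.act_basisVec i)]⟩)
    (fun i => Submodule.mem_map_of_mem (n.dualVec_mem i)) n.cyclicSum_eq_sum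

theorem isModular : IsModular n.level (fixedLattice n.rep) :=
  n.isDualFrame.isModular (s := n.revSign) (e := Fin.revPerm) fun i j => by
    have hn : (n.period : ℝ) ≠ 0 := Nat.cast_ne_zero.2 n.period_ne_zero
    have hgram : (n.period : ℝ) * ((n.revSign i : ℤ) * (n.revSign j : ℤ) *
        (∑ a, n.basisVec i.rev a * n.basisVec j.rev a : ℤ)) =
        n.level * (∑ a, n.dualVec i a * n.trace (n.dualVec j) a : ℤ) :=
      mod_cast n.basisVec_dot_basisVec i j
    rw [real_inner_smul_left, real_inner_smul_right,
      inner_cyclicSum_left (apply_cyclicSum (congrArg Subtype.val n.rep_pow_period) _),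
      cyclicSum_scaledEmb, Fin.revPerm_apply, Fin.revPerm_apply, Units.smul_def, Units.smul_def,
      ← Int.cast_smul_eq_zsmul ℝ, ← Int.cast_smul_eq_zsmul ℝ, real_inner_smul_left,
      real_inner_smul_right, inner_scaledEmb, inner_scaledEmb]
    field_simp
    linear_combination hgram

theorem orderOf_isStandardLift {g : MulAut LeechHat} (hg : IsStandardLift n.rep g) :
    orderOf g = n.level := by
  have hne : orderOf n.rep ≠ 0 := n.orderOf_rep ▸ n.period_ne_zero
  rcases n.level_eq_or with hl | ⟨hl, i, hi⟩
  · rw [hl, ← n.orderOf_rep]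
    refine hg.orderOf_eq (IsModular.even_traceNorm (pow_orderOf_eq_one n.rep) hne ?_)
    rw [n.orderOf_rep, ← hl]
    exact n.isModular
  · rw [hl, ← n.orderOf_rep]
    refine hg.orderOf_eq_two_mul hne
      (x := ⟨_, Submodule.mem_map_of_mem (n.dualVec_mem i)⟩) ?_
    have h8 : traceNorm n.rep (orderOf n.rep) ⟨_, Submodule.mem_map_of_mem (n.dualVec_mem i)⟩ * 8 =
        ∑ a, n.dualVec i a * n.trace (n.dualVec i) a := by
      refine Int.cast_injective (α := ℝ) ?_
      rw [Int.cast_mul, traceNorm_cast, n.orderOf_rep, cyclicSum_scaledEmb, inner_scaledEmb]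
      exact div_mul_cancel₀ _ (by norm_num)
    rw [Int.odd_iff]
    omega

end ClassName

end Representatives

end LeechDuality

theorem theorem4p2 (τ : LeechDuality.Co0) (hτ : τ ∈ LeechDuality.P0) :
    (∃ g : MulAut LeechDuality.LeechHat, LeechDuality.IsStandardLift τ g) ∧
    ∀ g : MulAut LeechDuality.LeechHat, LeechDuality.IsStandardLift τ g →
      ∃ φ : (√(orderOf g : ℝ) • LeechDuality.dualLattice (LeechDuality.fixedLattice τ) :
          Submodule ℤ LeechDuality.Space) ≃ₗ[ℤ] LeechDuality.fixedLattice τ,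
        ∀ x y, inner ℝ (φ x : LeechDuality.Space) (φ y : LeechDuality.Space) =
          inner ℝ (x : LeechDuality.Space) (y : LeechDuality.Space) := by
  refine ⟨LeechDuality.exists_isStandardLift τ, fun g hg => ?_⟩
  obtain ⟨n, hn⟩ := hτ
  obtain ⟨σ, rfl⟩ := isConj_iff.1 hn
  obtain ⟨s, hs⟩ := LeechDuality.exists_isStandardLift σ
  have horder : orderOf g = n.level := by
    rw [← n.orderOf_isStandardLift (hg.conj hs), ← MulAut.conj_symm_apply, MulEquiv.orderOf_eq]
  rw [horder, LeechDuality.fixedLattice_conj]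
  exact n.isModular.smul σ
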